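/- Fix $N\ge 1$, a wavelength $\lambda>0$, a resistance $R>0$ and path losses $\gamma_{DR},\gamma_{RS}>0$; put $k=2\pi/\lambda$. For a spacing $d>0$ let $Z_R\in\mathbb{C}^{N\times N}$ be the impedance matrix of a uniform linear array of isotropic radiators, $[Z_R]_{ii}=R$ and $[Z_R]_{ij}=-\frac{R}{\mathrm{j}kd|i-j|}e^{-\mathrm{j}kd|i-j|}$ for $i\ne j$; let $C_R=\frac1R\operatorname{Re}Z_R$, let $a(\alpha)\in\mathbb{C}^N$ have entries $a_n(\alpha)=e^{-\mathrm{j}(n-1)2\pi\frac d\lambda\cos\alpha}$, $n=1,\dots,N$, and let $a_0=a(0)$. For angles $\alpha_{Rx},\alpha_{Tx}\in\mathbb{R}$ and a reconfigurable network with impedance matrix $Z_N$, the line-of-sight channel with blocked direct path is $z=-z_{DR}^T(Z_R+Z_N)^{-1}z_{RS}$ with $z_{DR}=\sqrt{\gamma_{DR}}\,R\,a(\alpha_{Rx})$ and $z_{RS}=\sqrt{\gamma_{RS}}\,R\,a(\alpha_{Tx})$. The network is $Z_N=\mathrm{j}X$ with $X$ real diagonal (diagonal RIS) or real symmetric (fully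 connected BD-RIS). With the power matching decoupling network $$-\mathrm{j}\begin{bmatrix}0&\sqrt R\,(\operatorname{Re}Z_R)^{1/2}\\ \sqrt R\,(\operatorname{Re}Z_R)^{1/2}&\operatorname{Im}Z_R\end{bmatrix}=\begin{bmatrix}D_{11}&D_{12}\\D_{12}^T&D_{22}\end{bmatrix},$$ $Z_N$ is replaced by $D_{22}-D_{12}^T(D_{11}+\mathrm{j}X)^{-1}D_{12}$, with $X$ invertible of the same type. The array gain of an architecture is the supremum of $|z|^2$ over all admissible $X$, divided by the same supremum for one element. Denote it by $A_D, A_{BD}$ without and by $A_D^{DN},A_{BD}^{DN}$ with decoupling network. Then: 1. $\lim_{d\to0^+}a_0^HC_R^{-1}a_0=N^2$. For all $\alpha_{Rx},\alpha_{Tx}$ the limits of $A_D^{DN}$ and $A_{BD}^{DN}$ as $d\to0^+$ exist, and both are at most $(\lim_{d\to0^+}a_0^HC_R^{-1}a_0)^2=N^4$. 2. This bound is attained in the end-fire direction $\alpha_{Tx}=0$, $\alpha_{Rx}=\pi$: there $\lim_{d\to0^+}A_D^{DN}=\lim_{d\to0^+}A_{BD}^{DN}=N^4$. 3. For every $d>0$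 and all angles, $A_{BD}^{DN}=A_{BD}\ge A_D$. For every $d>0$ and every specular pair $\alpha_{Rx}=\pi-\alpha_{Tx}$, in particular in end-fire, $A_D^{DN}=A_{BD}\ge A_D$. 4. Hence a conventional diagonal RIS without decoupling network cannot exceed the gain $N^4$: for all $\alpha_{Rx},\alpha_{Tx}$, $\limsup_{d\to0^+}A_D\le N^4$. -/

import Mathlib

open Filter Topology
open scoped ENNReal Matrix

noncomputable section

namespace RIS

/-- Wave number `k = 2π / λ`. -/
def waveNumber (lam : ℝ) : ℝ := 2 * Real.pi / lam

/-- Impedance matrix `Z_R` of a uniform linear array of `N` isotropic radiators with spacing `d`,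
wavelength `lam` and radiation resistance `R`. -/
def impedanceMatrix (N : ℕ) (lam R d : ℝ) : Matrix (Fin N) (Fin N) ℂ :=
  Matrix.of fun i j =>
    if i = j then (R : ℂ)
    else
      -((R : ℂ) / (Complex.I * ((waveNumber lam * d * |(i : ℝ) - (j : ℝ)| : ℝ) : ℂ))) *
        Complex.exp (-(Complex.I * ((waveNumber lam * d * |(i : ℝ) - (j : ℝ)| : ℝ) : ℂ)))

/-- `Re Z_R`, entrywise. -/
def resistance (N : ℕ) (lam R d : ℝ) : Matrix (Fin N) (Fin N) ℝ :=
  (impedanceMatrix N lam R d).map Complex.re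

/-- `Im Z_R`, entrywise. -/
def reactance (N : ℕ) (lam R d : ℝ) : Matrix (Fin N) (Fin N) ℝ :=
  (impedanceMatrix N lam R d).map Complex.im

/-- The coupling matrix `C_R = Re Z_R / R`. -/
def couplingMatrix (N : ℕ) (lam R d : ℝ) : Matrix (Fin N) (Fin N) ℝ :=
  R⁻¹ • resistance N lam R d

/-- Line-of-sight array vector `a(α)`. The index `n : Fin N` starts at `0`. -/
def steering (N : ℕ) (lam d α : ℝ) : Fin N → ℂ :=
  fun n => Complex.exp
    (-(Complex.I * (((n : ℝ) * (2 * Real.pi) * (d / lam) * Real.cos α : ℝ) : ℂ)))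

/-- The quadratic form `a(α)ᴴ C_R⁻¹ a(α)`, the gain of a conventional transmit array. -/
def transmitGain (N : ℕ) (lam R d α : ℝ) : ℂ :=
  star (steering N lam d α) ⬝ᵥ
    (((couplingMatrix N lam R d)⁻¹).map Complex.ofReal *ᵥ steering N lam d α)

/-- The lossless network `j X` with real reactance matrix `X`. -/
def lossless {ι : Type*} (X : Matrix ι ι ℝ) : Matrix ι ι ℂ :=
  Complex.I • X.map Complex.ofReal

/-- Reactance matrices of fully-connected (beyond-diagonal) reciprocal lossless networks. -/
def fullyConnected (N : ℕ) : Set (Matrix (Fin N) (Fin N) ℝ) := {X | X.IsSymm}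

/-- Reactance matrices of diagonal (single-connected) lossless networks. -/
def singleConnected (N : ℕ) : Set (Matrix (Fin N) (Fin N) ℝ) :=
  Set.range fun x : Fin N → ℝ => Matrix.diagonal x

section Sqrt
open scoped MatrixOrder

/-- The power matching decoupling network, a `2N`-port
`-j [[0, √R (Re Z_R)^(1/2)], [√R (Re Z_R)^(1/2), Im Z_R]]`,
with the positive semidefinite square root of `Re Z_R`. -/
def powerMatching (N : ℕ) (lam R d : ℝ) : Matrix (Fin N ⊕ Fin N) (Fin N ⊕ Fin N) ℂ :=
  -lossless (Matrix.fromBlocks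
    0 (Real.sqrt R • CFC.sqrt (resistance N lam R d))
    (Real.sqrt R • CFC.sqrt (resistance N lam R d)) (reactance N lam R d))

end Sqrt

/-- The network seen at the array ports when the network `Z` terminates the first `N` ports of the
reciprocal `2N`-port `D`: `D₂₂ - D₁₂ᵀ (D₁₁ + Z)⁻¹ D₁₂`. -/
def throughNetwork {N : ℕ} (D : Matrix (Fin N ⊕ Fin N) (Fin N ⊕ Fin N) ℂ)
    (Z : Matrix (Fin N) (Fin N) ℂ) : Matrix (Fin N) (Fin N) ℂ :=
  D.toBlocks₂₂ - D.toBlocks₁₂ᵀ * (D.toBlocks₁₁ + Z)⁻¹ * D.toBlocks₁₂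

/-- End-to-end scalar channel `z_DS - z_DRᵀ (Z_R + Z_N)⁻¹ z_RS`. -/
def channel {N : ℕ} (zDS : ℂ) (zDR zRS : Fin N → ℂ) (ZR ZN : Matrix (Fin N) (Fin N) ℂ) : ℂ :=
  zDS - zDR ⬝ᵥ ((ZR + ZN)⁻¹ *ᵥ zRS)

/-- Line-of-sight channel with blocked direct path, for the adjustable network `ZN`:
`z_DS = 0`, `z_DR = √γ_DR R a(α_Rx)`, `z_RS = √γ_RS R a(α_Tx)`. -/
def losChannel (N : ℕ) (lam R γDR γRS αRx αTx d : ℝ) (ZN : Matrix (Fin N) (Fin N) ℂ) : ℂ :=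
  channel 0
    (((Real.sqrt γDR * R : ℝ) : ℂ) • steering N lam d αRx)
    (((Real.sqrt γRS * R : ℝ) : ℂ) • steering N lam d αTx)
    (impedanceMatrix N lam R d) ZN

/-- Optimal channel gain `sup |z|²` of a conventional RIS (no decoupling network) over the
architecture `S`. It is `ℝ≥0∞`-valued, so that the supremum is always the true one. -/
def channelGain (N : ℕ) (S : Set (Matrix (Fin N) (Fin N) ℝ))
    (lam R γDR γRS αRx αTx d : ℝ) : ℝ≥0∞ :=
  ⨆ X ∈ S, ENNReal.ofReal (‖losChannel N lam R γDR γRS αRx αTx d (lossless X)‖ ^ 2)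

/-- Optimal channel gain `sup |z|²` of a RIS with the power matching decoupling network. The
adjustable network has to be invertible for the combined network to have an impedance matrix. -/
def channelGainDN (N : ℕ) (S : Set (Matrix (Fin N) (Fin N) ℝ))
    (lam R γDR γRS αRx αTx d : ℝ) : ℝ≥0∞ :=
  ⨆ X ∈ {X ∈ S | IsUnit X},
    ENNReal.ofReal (‖losChannel N lam R γDR γRS αRx αTx d
      (throughNetwork (powerMatching N lam R d) (lossless X))‖ ^ 2)

/-- `A_D`: array gain (channel gain over the gain of one element), conventional diagonal RIS. -/
def gainD (N : ℕ) (lam R γDR γRS αRx αTx d : ℝ) : ℝ≥0∞ :=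
  channelGain N (singleConnected N) lam R γDR γRS αRx αTx d /
    channelGain 1 (singleConnected 1) lam R γDR γRS αRx αTx d

/-- `A_BD`: array gain of the fully-connected BD-RIS without decoupling network. -/
def gainBD (N : ℕ) (lam R γDR γRS αRx αTx d : ℝ) : ℝ≥0∞ :=
  channelGain N (fullyConnected N) lam R γDR γRS αRx αTx d /
    channelGain 1 (fullyConnected 1) lam R γDR γRS αRx αTx d

/-- `A_D^DN`: array gain of the diagonal RIS with decoupling network. -/
def gainDDN (N : ℕ) (lam R γDR γRS αRx αTx d : ℝ) : ℝ≥0∞ :=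
  channelGainDN N (singleConnected N) lam R γDR γRS αRx αTx d /
    channelGainDN 1 (singleConnected 1) lam R γDR γRS αRx αTx d

/-- `A_BD^DN`: array gain of the fully-connected BD-RIS with decoupling network. -/
def gainBDDN (N : ℕ) (lam R γDR γRS αRx αTx d : ℝ) : ℝ≥0∞ :=
  channelGainDN N (fullyConnected N) lam R γDR γRS αRx αTx d /
    channelGainDN 1 (fullyConnected 1) lam R γDR γRS αRx αTx d

end RIS

end

/-!
# Array gain of a reconfigurable surface with decoupling network

Write `Re Z_R = S²` with `S` real, symmetric and positive definite, and `w(α) = √R S⁻¹ a(α)`. For a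
load `X` the matrix `Z_R + Z_N` equals `S (1 + j W) S`, where `W` is a real symmetric matrix: without
decoupling network `S W S = X + Im Z_R`, with the power matching network `W = -R X⁻¹`. Hence the
channel is a constant times `w(α_Rx)ᵀ (1 + j W)⁻¹ w(α_Tx)`, and `(1 + j W)⁻¹ = (1 + U) / 2` with the
scattering matrix `U` of the load, a symmetric unitary matrix. Maximizing over `U` gives the gains
`((|uᵀ v| + |u| |v|) / 2)²` for fully-connected networks (`boundFull`; the supremum is the same over
all and over the invertible `W`) and `((|uᵀ v| + ∑ |uₙ vₙ|) / 2)²` for diagonal networks with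
decoupling (`boundDiag`), where `u = w(α_Rx)` and `v = w(α_Tx)`. That the first value is approached
uses that symmetric unitary matrices act transitively on spheres
(`exists_symmetric_unitary_mulVec_eq`) and the Cayley transform
(`exists_load_of_symmetric_unitary`). The two values are ordered by the Cauchy–Schwarz inequality,
and in specular directions `u` is the complex conjugate of `v`, so that both equal `|v|⁴`.

It remains to find the limit of `w(α)` as `d → 0`, where `Re Z_R` degenerates to a matrix of rank
one. The matrix `C_R` is the Gram matrix of the plane waves `exp (-j n k d t)` on `[-1, 1]`.
A Taylor expansion in the basis of the orthonormal Legendre polynomials `p₀, p₁, …` gives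
`a(α) = V D (p(cos α) + o(1))` and `C_R = V D (1 + o(1)) D Vᴴ` with `D = diag (1, d, d², …)` and a
matrix `V` with invertible limit (`eventually_gradedWave_sub_le`, `tendsto_gradedGram`). The matrix
`K = √R S⁻¹ V D` is therefore asymptotically unitary, and `Vᴴ K D⁻¹` is positive semidefinite. These
two properties force `K` to converge (`exists_tendsto_of_graded`): the grading makes `Vᴴ K`
lower triangular in the limit, and the Cholesky factor is unique. So `w(α)` tends to a unitary image
of `p(cos α)`, whose squared norm `∑ pₗ(cos α)²` is at most `∑ (2 l + 1) = N²`, with equality at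
`cos α = 1` (`legendre_eval_sq_le`, `legendre_eval_sq_of_sq_eq_one`).
-/

namespace RIS

/-! ### Orthonormal Legendre polynomials -/

section Legendre

open Polynomial

/-- The mean value of a real polynomial over `[-1, 1]`, as a linear functional. -/
noncomputable def polyMean : ℝ[X] →ₗ[ℝ] ℝ where
  toFun q := 1 / 2 * ∫ x in (-1 : ℝ)..1, q.eval x
  map_add' p q := by
    simp only [eval_add]
    rw [intervalIntegral.integral_add (p.continuous.intervalIntegrable _ _)
      (q.continuous.intervalIntegrable _ _)]
    ring
  map_smul' c q := by
    simp only [eval_smul, smul_eq_mul, RingHom.id_apply]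
    rw [intervalIntegral.integral_const_mul]
    ring

theorem polyMean_apply (q : ℝ[X]) : polyMean q = 1 / 2 * ∫ x in (-1 : ℝ)..1, q.eval x := rfl

theorem polyMean_derivative (q : ℝ[X]) :
    polyMean (derivative q) = 1 / 2 * (q.eval 1 - q.eval (-1)) := by
  rw [polyMean_apply, intervalIntegral.integral_eq_sub_of_hasDerivAt (f := fun x => q.eval x)
    (fun x _ => q.hasDerivAt x) ((derivative q).continuous.intervalIntegrable _ _)]

theorem polyMean_derivative_mul (p q : ℝ[X]) :
    polyMean (derivative p * q) =
      1 / 2 * (p.eval 1 * q.eval 1 - p.eval (-1) * q.eval (-1)) - polyMean (p * derivative q) := by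
  have h := polyMean_derivative (p * q)
  rw [derivative_mul, map_add, eval_mul, eval_mul] at h
  linarith

theorem polyMean_mul_self_pos {q : ℝ[X]} (hq : q ≠ 0) : 0 < polyMean (q * q) := by
  rw [polyMean_apply]
  have : ∃ c ∈ Set.Icc (-1 : ℝ) 1, q.eval c ≠ 0 := by
    by_contra! h
    exact hq (eq_zero_of_infinite_isRoot q
      ((Set.Icc_infinite (by norm_num : (-1 : ℝ) < 1)).mono fun x hx => h x hx))
  obtain ⟨c, hc, hqc⟩ := this
  have := intervalIntegral.integral_pos (f := fun x => (q * q).eval x)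
    (by norm_num : (-1 : ℝ) < 1) (q * q).continuous.continuousOn
    (fun x _ => by simpa using mul_self_nonneg _) ⟨c, hc, by simpa using hqc⟩
  positivity

/-- Rodrigues' formula for the unnormalized Legendre polynomial of degree `n`. -/
noncomputable def rodrigues (n : ℕ) : ℝ[X] := derivative^[n] ((X ^ 2 - 1) ^ n)

theorem natDegree_sq_sub_one_pow (n : ℕ) : ((X ^ 2 - 1 : ℝ[X]) ^ n).natDegree = n + n := by
  have h : (X ^ 2 - 1 : ℝ[X]) = X ^ 2 - C 1 := by simp
  rw [natDegree_pow, h, natDegree_X_pow_sub_C]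
  ring

theorem natDegree_rodrigues (n : ℕ) : (rodrigues n).natDegree = n := by
  refine natDegree_eq_of_le_of_coeff_ne_zero ?_ ?_
  · refine (natDegree_iterate_derivative _ n).trans ?_
    rw [natDegree_sq_sub_one_pow]
    omega
  · have hm : ((X ^ 2 - 1 : ℝ[X]) ^ n).Monic := by
      have h : (X ^ 2 - 1 : ℝ[X]) = X ^ 2 - C 1 := by simp
      rw [h]
      exact (monic_X_pow_sub_C 1 two_ne_zero).pow n
    have hc := hm.coeff_natDegree
    rw [natDegree_sq_sub_one_pow] at hc
    rw [rodrigues, coeff_iterate_derivative, hc, nsmul_eq_mul, mul_one]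
    exact_mod_cast (Nat.descFactorial_pos.2 (Nat.le_add_left n n)).ne'

theorem rodrigues_ne_zero (n : ℕ) : rodrigues n ≠ 0 := by
  intro h
  rcases Nat.eq_zero_or_pos n with rfl | hn
  · simp [rodrigues] at h
  · have := natDegree_rodrigues n
    rw [h, natDegree_zero] at this
    omega

theorem eval_iterate_derivative_sq_sub_one_pow {n k : ℕ} (hk : k < n) {x : ℝ} (hx : x ^ 2 = 1) :
    (derivative^[k] ((X ^ 2 - 1 : ℝ[X]) ^ n)).eval x = 0 := by
  obtain ⟨r, hr⟩ := pow_sub_dvd_iterate_derivative_pow (X ^ 2 - 1 : ℝ[X]) n k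
  rw [hr, eval_mul, eval_pow]
  have : n - k ≠ 0 := by omega
  simp [hx, this]

theorem polyMean_iterate_derivative_mul {n k : ℕ} (hk : k ≤ n) (q : ℝ[X]) :
    polyMean (derivative^[k] ((X ^ 2 - 1) ^ n) * q) =
      (-1) ^ k * polyMean ((X ^ 2 - 1) ^ n * derivative^[k] q) := by
  induction k generalizing q with
  | zero => simp
  | succ k ih =>
    rw [Function.iterate_succ_apply', polyMean_derivative_mul, ih (by omega),
      eval_iterate_derivative_sq_sub_one_pow (by omega) (by norm_num),
      eval_iterate_derivative_sq_sub_one_pow (by omega) (by norm_num),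
      ← Function.iterate_succ_apply]
    ring

theorem polyMean_rodrigues_mul {n : ℕ} {q : ℝ[X]} (hq : q.degree < n) :
    polyMean (rodrigues n * q) = 0 := by
  rw [rodrigues, polyMean_iterate_derivative_mul le_rfl]
  have : derivative^[n] q = 0 := by
    by_cases h : q = 0
    · simp [h]
    · exact iterate_derivative_eq_zero ((natDegree_lt_iff_degree_lt h).2 hq)
  simp [this]

/-- The Legendre polynomial of degree `n`, orthonormal for the uniform probability measure on
`[-1, 1]`. -/
noncomputable def legendre (n : ℕ) : ℝ[X] :=
  C (Real.sqrt (polyMean (rodrigues n * rodrigues n)))⁻¹ * rodrigues n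

theorem polyMean_sqrt_pos (n : ℕ) : 0 < Real.sqrt (polyMean (rodrigues n * rodrigues n)) :=
  Real.sqrt_pos.2 (polyMean_mul_self_pos (rodrigues_ne_zero n))

theorem natDegree_legendre (n : ℕ) : (legendre n).natDegree = n := by
  rw [legendre, natDegree_C_mul (inv_ne_zero (polyMean_sqrt_pos n).ne'), natDegree_rodrigues]

theorem legendre_ne_zero (n : ℕ) : legendre n ≠ 0 :=
  mul_ne_zero (C_ne_zero.2 (inv_ne_zero (polyMean_sqrt_pos n).ne')) (rodrigues_ne_zero n)

theorem degree_legendre (n : ℕ) : (legendre n).degree = n := by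
  rw [degree_eq_natDegree (legendre_ne_zero n), natDegree_legendre]

theorem polyMean_legendre_mul {n : ℕ} {q : ℝ[X]} (hq : q.degree < n) :
    polyMean (legendre n * q) = 0 := by
  rw [legendre, mul_assoc, ← smul_eq_C_mul, map_smul, polyMean_rodrigues_mul hq, smul_zero]

theorem polyMean_mul_legendre {n : ℕ} {q : ℝ[X]} (hq : q.degree < n) :
    polyMean (q * legendre n) = 0 := by
  rw [mul_comm, polyMean_legendre_mul hq]

theorem polyMean_legendre_mul_self (n : ℕ) : polyMean (legendre n * legendre n) = 1 := by
  have h := polyMean_sqrt_pos n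
  have h2 := Real.mul_self_sqrt (polyMean_mul_self_pos (rodrigues_ne_zero n)).le
  have : legendre n * legendre n =
      ((Real.sqrt (polyMean (rodrigues n * rodrigues n)))⁻¹ *
        (Real.sqrt (polyMean (rodrigues n * rodrigues n)))⁻¹) • (rodrigues n * rodrigues n) := by
    rw [legendre, smul_eq_C_mul, C_mul]
    ring
  rw [this, map_smul, smul_eq_mul]
  nth_rewrite 3 [← h2]
  field_simp

theorem polyMean_legendre_mul_legendre (m n : ℕ) :
    polyMean (legendre m * legendre n) = if m = n then 1 else 0 := by
  rcases lt_trichotomy m n with h | rfl | h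
  · rw [if_neg h.ne, polyMean_mul_legendre (by rw [degree_legendre]; exact_mod_cast h)]
  · rw [if_pos rfl, polyMean_legendre_mul_self]
  · rw [if_neg h.ne', polyMean_legendre_mul (by rw [degree_legendre]; exact_mod_cast h)]

theorem coeff_legendre_self_ne_zero (n : ℕ) : (legendre n).coeff n ≠ 0 := by
  have := leadingCoeff_ne_zero.2 (legendre_ne_zero n)
  rwa [leadingCoeff, natDegree_legendre] at this

/-- Legendre expansion of a polynomial of degree less than `N`. -/
theorem eq_sum_legendre {N : ℕ} {q : ℝ[X]} (hq : q.degree < N) :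
    q = ∑ l ∈ Finset.range N, polyMean (q * legendre l) • legendre l := by
  induction N generalizing q with
  | zero => simpa [Polynomial.degree_lt_iff_coeff_zero, Polynomial.ext_iff] using hq
  | succ N ih =>
    set c := q.coeff N / (legendre N).coeff N with hc
    have hdeg : (q - c • legendre N).degree < N := by
      rw [degree_lt_iff_coeff_zero] at hq ⊢
      intro m hm
      rcases hm.eq_or_lt with rfl | hm
      · simp only [coeff_sub, coeff_smul, smul_eq_mul, hc]
        field_simp [coeff_legendre_self_ne_zero N]
        ring
      · rw [coeff_sub, coeff_smul, hq m hm,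
          coeff_eq_zero_of_natDegree_lt (by rwa [natDegree_legendre])]
        simp
    have hcN : polyMean (q * legendre N) = c := by
      have := polyMean_mul_legendre hdeg
      rw [sub_mul, map_sub, smul_mul_assoc, map_smul, polyMean_legendre_mul_self] at this
      simpa [sub_eq_zero] using this
    rw [Finset.sum_range_succ, hcN]
    have h := ih hdeg
    rw [← sub_eq_iff_eq_add]
    refine h.trans (Finset.sum_congr rfl fun l hl => ?_)
    rw [sub_mul, map_sub, smul_mul_assoc, map_smul, polyMean_legendre_mul_legendre,
      if_neg (Finset.mem_range.1 hl).ne']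
    simp

theorem polyMean_X_pow_mul_legendre_eq_zero {m l : ℕ} (h : m < l) :
    polyMean (X ^ m * legendre l) = 0 :=
  polyMean_mul_legendre (by rw [degree_X_pow]; exact_mod_cast h)

theorem polyMean_X_pow_mul_legendre_self_ne_zero (n : ℕ) :
    polyMean (X ^ n * legendre n) ≠ 0 := by
  intro h
  -- otherwise `X ^ n` would have a Legendre expansion of degree less than `n`
  have hx := eq_sum_legendre (N := n + 1) (q := X ^ n)
    (by rw [degree_X_pow]; exact_mod_cast Nat.lt_succ_self n)
  rw [Finset.sum_range_succ, h, zero_smul, add_zero] at hx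
  have := congrArg (fun p => coeff p n) hx
  simp only [coeff_X_pow, if_true, finsetSum_coeff, coeff_smul] at this
  rw [Finset.sum_eq_zero] at this
  · exact one_ne_zero this
  · intro l hl
    rw [coeff_eq_zero_of_natDegree_lt (by rw [natDegree_legendre]; exact Finset.mem_range.1 hl)]
    simp

theorem polyMean_sturmLiouville (p q : ℝ[X]) :
    polyMean (derivative ((1 - X ^ 2) * derivative p) * q) =
      polyMean (p * derivative ((1 - X ^ 2) * derivative q)) := by
  rw [mul_comm p, polyMean_derivative_mul, polyMean_derivative_mul]
  simp only [eval_mul, eval_sub, eval_one, eval_pow, eval_X]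
  have : (1 - X ^ 2) * derivative p * derivative q = (1 - X ^ 2) * derivative q * derivative p := by
    ring
  rw [this]
  norm_num

theorem coeff_sturmLiouville (p : ℝ[X]) (m : ℕ) :
    (derivative ((1 - X ^ 2) * derivative p)).coeff m =
      (m + 1) * (m + 2) * p.coeff (m + 2) - m * (m + 1) * p.coeff m := by
  have h : (1 - X ^ 2) * derivative p = derivative p - derivative p * X ^ 2 := by ring
  rw [h, coeff_derivative, coeff_sub, coeff_derivative, coeff_mul_X_pow']
  rcases Nat.eq_zero_or_pos m with rfl | hm
  · norm_num
    ring
  · obtain ⟨k, rfl⟩ : ∃ k, m = k + 1 := ⟨m - 1, by omega⟩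
    rw [if_pos (by omega), show k + 1 + 1 - 2 = k by omega, coeff_derivative]
    push_cast
    ring

/-- Legendre's differential equation. It holds because the Sturm–Liouville operator is symmetric
and does not raise degrees, so that it preserves the orthogonal complement of the polynomials of
degree less than `n`. -/
theorem legendre_ode (n : ℕ) :
    derivative ((1 - X ^ 2) * derivative (legendre n)) = C (-(n * (n + 1) : ℝ)) * legendre n := by
  set r := derivative ((1 - X ^ 2) * derivative (legendre n)) -
    C (-(n * (n + 1) : ℝ)) * legendre n with hr
  have hcoeff : ∀ m, n < m → (legendre n).coeff m = 0 := fun m hm =>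
    coeff_eq_zero_of_natDegree_lt (by rwa [natDegree_legendre])
  have hdeg : r.degree < n := by
    rw [degree_lt_iff_coeff_zero]
    intro m hm
    rw [hr, coeff_sub, coeff_sturmLiouville, coeff_C_mul, hcoeff (m + 2) (by omega)]
    rcases hm.eq_or_lt with rfl | hm
    · ring
    · rw [hcoeff m hm]
      ring
  have hdeg2 : (derivative ((1 - X ^ 2) * derivative r)).degree < n := by
    rw [degree_lt_iff_coeff_zero] at hdeg ⊢
    intro m hm
    rw [coeff_sturmLiouville, hdeg m hm, hdeg (m + 2) (by omega)]
    ring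
  have hzero : polyMean (r * r) = 0 := by
    conv_lhs => rw [hr, sub_mul, map_sub, polyMean_sturmLiouville, polyMean_legendre_mul hdeg2,
      mul_assoc, ← smul_eq_C_mul, map_smul, polyMean_legendre_mul hdeg]
    simp
  by_contra hne
  exact (polyMean_mul_self_pos (sub_ne_zero.2 hne)).ne' hzero

/-- The square of an orthonormal Legendre polynomial takes the value `2 n + 1` at an end point
`s = ± 1`: integrate the derivative of `(X + s) pₙ²`, where `(X + s) pₙ' - n pₙ` has degree
less than `n`. -/
theorem legendre_eval_sq_of_sq_eq_one (n : ℕ) {s : ℝ} (hs : s = 1 ∨ s = -1) :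
    (legendre n).eval s ^ 2 = 2 * n + 1 := by
  have hdeg : ((X + C s) * derivative (legendre n) - C (n : ℝ) * legendre n).degree <
      (n : WithBot ℕ) := by
    rw [degree_lt_iff_coeff_zero]
    intro m hm
    have hcoeff : ∀ m, n < m → (legendre n).coeff m = 0 := fun m hm =>
      coeff_eq_zero_of_natDegree_lt (by rwa [natDegree_legendre])
    rw [add_mul, coeff_sub, coeff_add, coeff_C_mul, coeff_C_mul, coeff_derivative,
      hcoeff (m + 1) (by omega)]
    rcases Nat.eq_zero_or_pos m with rfl | hm0
    · obtain rfl : n = 0 := by omega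
      simp
    · obtain ⟨k, rfl⟩ : ∃ k, m = k + 1 := ⟨m - 1, by omega⟩
      rw [coeff_X_mul, coeff_derivative]
      rcases hm.eq_or_lt with rfl | hm
      · push_cast
        ring
      · rw [hcoeff _ hm]
        ring
  have h1 := polyMean_legendre_mul hdeg
  have h2 := polyMean_legendre_mul_self n
  have h3 := polyMean_derivative ((X + C s) * (legendre n * legendre n))
  have e : derivative ((X + C s) * (legendre n * legendre n)) =
      (1 + 2 * n : ℝ) • (legendre n * legendre n) + (2 : ℝ) •
        (legendre n * ((X + C s) * derivative (legendre n) - C (n : ℝ) * legendre n)) := by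
    simp only [derivative_mul, derivative_add, derivative_X, derivative_C, smul_eq_C_mul, C_add,
      C_mul, C_1, map_ofNat]
    ring
  rw [e, map_add, map_smul, map_smul, h1, h2] at h3
  rcases hs with rfl | rfl <;> simp at h3 <;> linarith

/-- On `[-1, 1]` an orthonormal Legendre polynomial is largest at the end points. By the
differential equation `F = n (n + 1) pₙ² + (1 - x²) pₙ'²` has derivative `2 x pₙ'²`, so `F` is
largest at the end points. -/
theorem legendre_eval_sq_le (n : ℕ) {x : ℝ} (hx : x ∈ Set.Icc (-1 : ℝ) 1) :
    (legendre n).eval x ^ 2 ≤ 2 * n + 1 := by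
  rcases Nat.eq_zero_or_pos n with rfl | hn
  · have h0 := eq_C_of_natDegree_eq_zero (natDegree_legendre 0)
    have h1 := legendre_eval_sq_of_sq_eq_one 0 (s := 1) (Or.inl rfl)
    rw [h0] at h1 ⊢
    simpa using h1.le
  set P := legendre n
  set F : ℝ[X] := C (n * (n + 1) : ℝ) * (P * P) +
    (1 - X ^ 2) * derivative P * derivative P with hF
  have hF' : derivative F = 2 * X * (derivative P * derivative P) := by
    have h := legendre_ode n
    have h' : derivative ((1 - X ^ 2) * derivative P) =
        (1 - X ^ 2) * derivative (derivative P) - 2 * X * derivative P := by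
      have hC : (C 2 : ℝ[X]) = 2 := map_ofNat C 2
      simp only [derivative_mul, derivative_sub, derivative_one, derivative_X_sq, hC]
      ring
    have h2 : (1 - X ^ 2) * derivative (derivative P) =
        2 * X * derivative P - C (n * (n + 1) : ℝ) * P := by
      rw [← sub_eq_iff_eq_add'.2 (sub_eq_iff_eq_add.1 h'.symm), h, C_neg]
      ring
    rw [hF, derivative_add, derivative_mul, derivative_mul, derivative_mul,
      derivative_C, h, C_neg]
    linear_combination derivative P * h2
  have hFx : ∀ y, F.eval y = n * (n + 1) * P.eval y ^ 2 +
      (1 - y ^ 2) * (derivative P).eval y ^ 2 := by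
    intro y
    simp [hF]
    ring
  have hderiv : ∀ y, deriv (fun x => F.eval x) y = 2 * y * (derivative P).eval y ^ 2 := by
    intro y
    rw [Polynomial.deriv, hF']
    simp only [eval_mul, eval_ofNat, eval_X]
    ring
  have hmax : F.eval x ≤ n * (n + 1) * (2 * n + 1) := by
    rcases le_total 0 x with h0 | h0
    · have hm : MonotoneOn (fun x => F.eval x) (Set.Icc 0 1) := by
        refine monotoneOn_of_deriv_nonneg (convex_Icc _ _) F.continuous.continuousOn
          F.differentiable.differentiableOn fun y hy => ?_
        rw [interior_Icc] at hy
        rw [hderiv]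
        have := hy.1
        positivity
      have := hm ⟨h0, hx.2⟩ ⟨zero_le_one, le_rfl⟩ hx.2
      simp only [hFx 1, P, legendre_eval_sq_of_sq_eq_one n (Or.inl rfl)] at this
      simpa using this
    · have hm : AntitoneOn (fun x => F.eval x) (Set.Icc (-1) 0) := by
        refine antitoneOn_of_deriv_nonpos (convex_Icc _ _) F.continuous.continuousOn
          F.differentiable.differentiableOn fun y hy => ?_
        rw [interior_Icc] at hy
        rw [hderiv]
        have := hy.2
        nlinarith [sq_nonneg ((derivative P).eval y)]
      have := hm ⟨le_rfl, by norm_num⟩ ⟨hx.1, h0⟩ hx.1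
      simp only [hFx (-1), P, legendre_eval_sq_of_sq_eq_one n (Or.inr rfl)] at this
      simpa using this
  rw [hFx] at hmax
  have hn' : (0 : ℝ) < n * (n + 1) := by positivity
  have h1 : 0 ≤ (1 - x ^ 2) * (derivative P).eval x ^ 2 := by
    have : 0 ≤ 1 - x ^ 2 := by nlinarith [hx.1, hx.2]
    positivity
  exact le_of_mul_le_mul_left (by linarith) hn'

theorem sum_two_mul_add_one (N : ℕ) : ∑ l : Fin N, (2 * (l : ℝ) + 1) = (N : ℝ) ^ 2 := by
  rw [Fin.sum_univ_eq_sum_range (fun l => 2 * (l : ℝ) + 1)]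
  induction N with
  | zero => simp
  | succ N ih =>
    rw [Finset.sum_range_succ, ih]
    push_cast
    ring

end Legendre

/-! ### The coupling matrix as a Gram matrix of plane waves -/

/-- The vector of the plane waves `t ↦ exp (-j n κ t)`, `n < N`, at `t`. Here `κ = k d` is the
electrical spacing and `t = cos α`. -/
noncomputable def planeWave (N : ℕ) (κ t : ℝ) : Fin N → ℂ :=
  fun n => Complex.exp (-(Complex.I * κ * t) * n)

theorem steering_eq_planeWave (N : ℕ) (lam d α : ℝ) :
    steering N lam d α = planeWave N (waveNumber lam * d) (Real.cos α) := by
  funext n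
  simp only [steering, planeWave, waveNumber]
  congr 1
  push_cast
  ring

theorem continuous_planeWave (N : ℕ) (κ : ℝ) (n : Fin N) :
    Continuous fun t => planeWave N κ t n := by
  unfold planeWave
  fun_prop

theorem star_planeWave (N : ℕ) (κ t : ℝ) (n : Fin N) :
    star (planeWave N κ t n) = Complex.exp (Complex.I * κ * t * n) := by
  rw [planeWave, ← starRingEnd_apply, ← Complex.exp_conj]
  congr 1
  simp

theorem planeWave_neg (N : ℕ) (κ t : ℝ) : planeWave N κ (-t) = star (planeWave N κ t) := by
  funext n
  rw [Pi.star_apply, star_planeWave, planeWave]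
  congr 1
  push_cast
  ring

theorem planeWave_mul_star (N : ℕ) (κ t : ℝ) (i j : Fin N) :
    planeWave N κ t i * star (planeWave N κ t j) =
      Complex.exp (-(Complex.I * (κ * ((i : ℝ) - (j : ℝ)) : ℝ)) * t) := by
  rw [star_planeWave, planeWave, ← Complex.exp_add]
  congr 1
  push_cast
  ring

theorem sin_abs_div_abs (x : ℝ) : Real.sin |x| / |x| = Real.sin x / x := by
  rcases abs_choice x with h | h <;> simp [h]

theorem resistance_apply_of_ne {N : ℕ} {lam R d : ℝ} (hlam : 0 < lam) (hd : 0 < d) {i j : Fin N}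
    (hij : i ≠ j) : resistance N lam R d i j =
      R * (Real.sin (waveNumber lam * d * ((i : ℝ) - (j : ℝ))) /
        (waveNumber lam * d * ((i : ℝ) - (j : ℝ)))) := by
  have hκ : 0 < waveNumber lam * d := by unfold waveNumber; positivity
  rw [← sin_abs_div_abs, abs_mul, abs_of_pos hκ]
  have hx : waveNumber lam * d * |(i : ℝ) - (j : ℝ)| ≠ 0 := by
    refine mul_ne_zero hκ.ne' (abs_ne_zero.2 (sub_ne_zero.2 ?_))
    exact_mod_cast fun h => hij (Fin.ext h)
  simp only [resistance, impedanceMatrix, Matrix.map_apply, Matrix.of_apply, if_neg hij]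
  set x := waveNumber lam * d * |(i : ℝ) - (j : ℝ)|
  have hx' : (x : ℂ) ≠ 0 := by exact_mod_cast hx
  have e : -((R : ℂ) / (Complex.I * x)) * Complex.exp (-(Complex.I * x)) =
      ((R * (Real.sin x / x) : ℝ) : ℂ) + ((R * (Real.cos x / x) : ℝ) : ℂ) * Complex.I := by
    have : -(Complex.I * x) = ((-x : ℝ) : ℂ) * Complex.I := by push_cast; ring
    rw [this, Complex.exp_mul_I, ← Complex.ofReal_cos, ← Complex.ofReal_sin, Real.cos_neg,
      Real.sin_neg]
    push_cast
    field_simp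
    linear_combination (-(R * Complex.cos x) : ℂ) * Complex.I_sq
  rw [e, Complex.add_re, Complex.ofReal_re, Complex.re_ofReal_mul]
  simp

theorem resistance_apply_self {N : ℕ} {lam R d : ℝ} (i : Fin N) :
    resistance N lam R d i i = R := by
  simp [resistance, impedanceMatrix]

theorem integral_exp_neg_I_mul {y : ℝ} (hy : y ≠ 0) :
    ∫ t in (-1 : ℝ)..1, Complex.exp (-(Complex.I * (y : ℂ)) * t) =
      ((2 * (Real.sin y / y) : ℝ) : ℂ) := by
  have hy' : (y : ℂ) ≠ 0 := by exact_mod_cast hy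
  rw [integral_exp_mul_complex (neg_ne_zero.2 (mul_ne_zero Complex.I_ne_zero hy'))]
  push_cast
  have e1 : -(Complex.I * (y : ℂ)) * 1 = ((-y : ℝ) : ℂ) * Complex.I := by push_cast; ring
  have e2 : -(Complex.I * (y : ℂ)) * (-1) = (y : ℂ) * Complex.I := by ring
  rw [e1, e2, Complex.exp_mul_I, Complex.exp_mul_I, Complex.ofReal_neg, Complex.cos_neg,
    Complex.sin_neg]
  field_simp
  ring

theorem couplingMatrix_eq_integral {N : ℕ} {lam R d : ℝ} (hlam : 0 < lam) (hR : 0 < R)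
    (hd : 0 < d) (i j : Fin N) :
    ((couplingMatrix N lam R d i j : ℝ) : ℂ) = 1 / 2 * ∫ t in (-1 : ℝ)..1,
      planeWave N (waveNumber lam * d) t i * star (planeWave N (waveNumber lam * d) t j) := by
  simp only [planeWave_mul_star, couplingMatrix, Matrix.smul_apply, smul_eq_mul]
  by_cases hij : i = j
  · subst hij
    rw [resistance_apply_self, inv_mul_cancel₀ hR.ne']
    simp
    norm_num
  · have hκ : 0 < waveNumber lam * d := by unfold waveNumber; positivity
    rw [resistance_apply_of_ne hlam hd hij, integral_exp_neg_I_mul, ← mul_assoc,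
      inv_mul_cancel₀ hR.ne']
    · push_cast
      ring
    · refine mul_ne_zero hκ.ne' (sub_ne_zero.2 ?_)
      exact_mod_cast fun h => hij (Fin.ext h)

theorem couplingMatrix_isSymm {N : ℕ} {lam R d : ℝ} (hlam : 0 < lam) (hd : 0 < d) :
    (couplingMatrix N lam R d).IsSymm := by
  refine Matrix.IsSymm.ext fun i j => ?_
  simp only [couplingMatrix, Matrix.smul_apply]
  by_cases hij : i = j
  · rw [hij]
  · rw [resistance_apply_of_ne hlam hd hij, resistance_apply_of_ne hlam hd (Ne.symm hij),
      ← neg_sub (j : ℝ) (i : ℝ), mul_neg, Real.sin_neg, neg_div_neg_eq]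

/-- Plane waves with different `n` are linearly independent on `[-1, 1]`: a relation between them
is a polynomial with infinitely many zeros `exp (-j κ t)`. -/
theorem exists_sum_mul_planeWave_ne_zero {N : ℕ} {κ : ℝ} (hκ : 0 < κ) {x : Fin N → ℝ}
    (hx : x ≠ 0) : ∃ t ∈ Set.Icc (-1 : ℝ) 1, ∑ i, (x i : ℂ) * planeWave N κ t i ≠ 0 := by
  by_contra! h
  set p : Polynomial ℂ := ∑ i : Fin N, Polynomial.C (x i : ℂ) * Polynomial.X ^ (i : ℕ) with hp
  have hev : ∀ t ∈ Set.Icc (-1 : ℝ) 1, p.eval (Complex.exp (-(Complex.I * κ * t))) = 0 := by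
    intro t ht
    rw [← h t ht, hp, Polynomial.eval_finsetSum]
    refine Finset.sum_congr rfl fun i _ => ?_
    rw [Polynomial.eval_C_mul, Polynomial.eval_pow, Polynomial.eval_X, ← Complex.exp_nat_mul,
      planeWave, mul_comm ((i : ℕ) : ℂ)]
  -- on `[0, δ]` the phase `κ t` stays below `1 < π`, so that `t ↦ exp (-j κ t)` is injective
  set δ := min 1 κ⁻¹
  have hδ : 0 < δ := lt_min one_pos (inv_pos.2 hκ)
  have hinj : Set.InjOn (fun t : ℝ => Complex.exp (-(Complex.I * κ * t))) (Set.Icc 0 δ) := by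
    intro s hs t ht hst
    have him : ∀ r : ℝ, (-(Complex.I * κ * r)).im = -(κ * r) := by intro r; simp
    have hb : ∀ r ∈ Set.Icc 0 δ, 0 ≤ κ * r ∧ κ * r ≤ 1 := by
      intro r hr
      refine ⟨mul_nonneg hκ.le hr.1, ?_⟩
      calc κ * r ≤ κ * κ⁻¹ := by
            gcongr
            exact hr.2.trans (min_le_right _ _)
        _ = 1 := mul_inv_cancel₀ hκ.ne'
    have := Complex.exp_inj_of_neg_pi_lt_of_le_pi
      (by rw [him]; linarith [(hb s hs).2, Real.pi_gt_three])
      (by rw [him]; linarith [(hb s hs).1, Real.pi_gt_three])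
      (by rw [him]; linarith [(hb t ht).2, Real.pi_gt_three])
      (by rw [him]; linarith [(hb t ht).1, Real.pi_gt_three]) hst
    have := congrArg Complex.im this
    rw [him, him, neg_inj] at this
    exact mul_left_cancel₀ hκ.ne' this
  have hp0 : p = 0 := by
    refine Polynomial.eq_zero_of_infinite_isRoot p
      (((Set.Icc_infinite hδ).image hinj).mono ?_)
    rintro _ ⟨t, ht, rfl⟩
    exact hev t ⟨by linarith [ht.1], ht.2.trans (min_le_left _ _)⟩
  refine hx (funext fun i => ?_)
  have := congrArg (fun q => Polynomial.coeff q (i : ℕ)) hp0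
  simpa [hp, Polynomial.finsetSum_coeff, Polynomial.coeff_X_pow, Fin.val_inj] using this

theorem couplingMatrix_posDef {N : ℕ} {lam R d : ℝ} (hlam : 0 < lam) (hR : 0 < R) (hd : 0 < d) :
    (couplingMatrix N lam R d).PosDef := by
  have hκ : 0 < waveNumber lam * d := by unfold waveNumber; positivity
  refine Matrix.PosDef.of_dotProduct_mulVec_pos (by
    rw [Matrix.IsHermitian, Matrix.conjTranspose_eq_transpose_of_trivial]
    exact couplingMatrix_isSymm hlam hd) fun {x} hx => ?_
  set κ := waveNumber lam * d with hκd
  set f : ℝ → ℂ := fun t => ∑ i, (x i : ℂ) * planeWave N κ t i with hf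
  have hfc : Continuous f :=
    continuous_finsetSum _ fun i _ => continuous_const.mul (continuous_planeWave N κ i)
  have key : star x ⬝ᵥ couplingMatrix N lam R d *ᵥ x =
      1 / 2 * ∫ t in (-1 : ℝ)..1, Complex.normSq (f t) := by
    apply Complex.ofReal_injective
    have h1 : ∀ t, ((Complex.normSq (f t) : ℝ) : ℂ) = ∑ i, ∑ j, (x i : ℂ) * x j *
        (planeWave N κ t i * star (planeWave N κ t j)) := by
      intro t
      rw [← Complex.mul_conj, hf, map_sum, Finset.sum_mul_sum]
      refine Finset.sum_congr rfl fun i _ => Finset.sum_congr rfl fun j _ => ?_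
      rw [map_mul, Complex.conj_ofReal, starRingEnd_apply]
      ring
    have hc : ∀ i j, Continuous fun t => (x i : ℂ) * x j *
        (planeWave N κ t i * star (planeWave N κ t j)) := fun i j =>
      continuous_const.mul ((continuous_planeWave N κ i).mul (continuous_planeWave N κ j).star)
    rw [Complex.ofReal_mul, ← intervalIntegral.integral_ofReal]
    simp_rw [h1]
    rw [intervalIntegral.integral_finsetSum fun i _ =>
      (continuous_finsetSum _ fun j _ => hc i j).intervalIntegrable _ _]
    simp only [dotProduct, Matrix.mulVec, Pi.star_apply, star_trivial, Complex.ofReal_sum,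
      Finset.mul_sum, Complex.ofReal_mul]
    refine Finset.sum_congr rfl fun i _ => ?_
    rw [intervalIntegral.integral_finsetSum fun j _ => (hc i j).intervalIntegrable _ _,
      Finset.mul_sum]
    refine Finset.sum_congr rfl fun j _ => ?_
    rw [couplingMatrix_eq_integral hlam hR hd, intervalIntegral.integral_const_mul]
    push_cast
    ring
  obtain ⟨t, ht, hne⟩ := exists_sum_mul_planeWave_ne_zero hκ hx
  rw [key]
  have := intervalIntegral.integral_pos (f := fun t => Complex.normSq (f t))
    (by norm_num : (-1 : ℝ) < 1) (Complex.continuous_normSq.comp hfc).continuousOn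
    (fun t _ => Complex.normSq_nonneg _) ⟨t, ht, Complex.normSq_pos.2 hne⟩
  positivity

theorem resistance_eq_smul {N : ℕ} {lam R d : ℝ} (hR : 0 < R) :
    resistance N lam R d = R • couplingMatrix N lam R d := by
  rw [couplingMatrix, smul_smul, mul_inv_cancel₀ hR.ne', one_smul]

theorem resistance_posDef {N : ℕ} {lam R d : ℝ} (hlam : 0 < lam) (hR : 0 < R) (hd : 0 < d) :
    (resistance N lam R d).PosDef := by
  rw [resistance_eq_smul hR]
  exact (couplingMatrix_posDef hlam hR hd).smul hR

theorem reactance_isSymm (N : ℕ) (lam R d : ℝ) : (reactance N lam R d).IsSymm := by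
  refine Matrix.IsSymm.ext fun i j => ?_
  simp only [reactance, impedanceMatrix, Matrix.map_apply, Matrix.of_apply, eq_comm (a := i),
    abs_sub_comm (i : ℝ)]

theorem impedanceMatrix_eq (N : ℕ) (lam R d : ℝ) :
    impedanceMatrix N lam R d =
      (resistance N lam R d).map Complex.ofReal + lossless (reactance N lam R d) := by
  ext i j
  simp only [resistance, reactance, lossless, Matrix.add_apply, Matrix.map_apply,
    Matrix.smul_apply, smul_eq_mul]
  rw [mul_comm]
  exact (Complex.re_add_im _).symm

open scoped MatrixOrder in
/-- The positive definite square root of `Re Z_R`. -/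
noncomputable def sqrtResistance (N : ℕ) (lam R d : ℝ) : Matrix (Fin N) (Fin N) ℝ :=
  CFC.sqrt (resistance N lam R d)

open scoped MatrixOrder in
theorem sqrtResistance_mul_self {N : ℕ} {lam R d : ℝ} (hlam : 0 < lam) (hR : 0 < R)
    (hd : 0 < d) :
    sqrtResistance N lam R d * sqrtResistance N lam R d = resistance N lam R d :=
  CFC.sqrt_mul_sqrt_self _ (resistance_posDef hlam hR hd).posSemidef.nonneg

open scoped MatrixOrder in
theorem sqrtResistance_posSemidef (N : ℕ) (lam R d : ℝ) :
    (sqrtResistance N lam R d).PosSemidef :=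
  Matrix.nonneg_iff_posSemidef.1 (CFC.sqrt_nonneg _)

theorem sqrtResistance_isSymm (N : ℕ) (lam R d : ℝ) : (sqrtResistance N lam R d).IsSymm := by
  have := (sqrtResistance_posSemidef N lam R d).isHermitian
  rwa [Matrix.IsHermitian, Matrix.conjTranspose_eq_transpose_of_trivial] at this

theorem isUnit_sqrtResistance {N : ℕ} {lam R d : ℝ} (hlam : 0 < lam) (hR : 0 < R)
    (hd : 0 < d) : IsUnit (sqrtResistance N lam R d) := by
  have h := (resistance_posDef (N := N) hlam hR hd).isUnit
  rw [← sqrtResistance_mul_self hlam hR hd] at h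
  exact isUnit_of_mul_isUnit_left h

/-- The square root of `Re Z_R` as a complex matrix. -/
noncomputable abbrev sqrtResistanceC (N : ℕ) (lam R d : ℝ) : Matrix (Fin N) (Fin N) ℂ :=
  (sqrtResistance N lam R d).map Complex.ofReal

theorem map_ofReal_mul {n : Type*} [Fintype n] (A B : Matrix n n ℝ) :
    (A * B).map Complex.ofReal = A.map Complex.ofReal * B.map Complex.ofReal :=
  Matrix.map_mul (f := Complex.ofRealHom)

theorem isUnit_map_ofReal {n : Type*} [Fintype n] [DecidableEq n] {A : Matrix n n ℝ}
    (hA : IsUnit A) : IsUnit (A.map Complex.ofReal) :=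
  hA.map (Complex.ofRealHom.mapMatrix (m := n))

theorem map_ofReal_inv {n : Type*} [Fintype n] [DecidableEq n] {A : Matrix n n ℝ}
    (hA : IsUnit A) : A⁻¹.map Complex.ofReal = (A.map Complex.ofReal)⁻¹ := by
  refine (Matrix.inv_eq_left_inv ?_).symm
  rw [← map_ofReal_mul, Matrix.nonsing_inv_mul _ ((Matrix.isUnit_iff_isUnit_det _).1 hA)]
  exact Matrix.map_one _ Complex.ofReal_zero Complex.ofReal_one

theorem sqrtResistanceC_mul_self {N : ℕ} {lam R d : ℝ} (hlam : 0 < lam) (hR : 0 < R)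
    (hd : 0 < d) : sqrtResistanceC N lam R d * sqrtResistanceC N lam R d =
      (resistance N lam R d).map Complex.ofReal := by
  rw [← map_ofReal_mul, sqrtResistance_mul_self hlam hR hd]

theorem sqrtResistanceC_transpose (N : ℕ) (lam R d : ℝ) :
    (sqrtResistanceC N lam R d)ᵀ = sqrtResistanceC N lam R d := by
  rw [← Matrix.transpose_map, (sqrtResistance_isSymm N lam R d).eq]

theorem sqrtResistanceC_conjTranspose (N : ℕ) (lam R d : ℝ) :
    (sqrtResistanceC N lam R d)ᴴ = sqrtResistanceC N lam R d := by
  ext i j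
  have := (sqrtResistance_isSymm N lam R d).apply i j
  simp [this]

theorem isUnit_sqrtResistanceC {N : ℕ} {lam R d : ℝ} (hlam : 0 < lam) (hR : 0 < R)
    (hd : 0 < d) : IsUnit (sqrtResistanceC N lam R d) :=
  isUnit_map_ofReal (isUnit_sqrtResistance hlam hR hd)

/-- The whitened array vector `C_R^(-1/2) a(α)`. -/
noncomputable def whitened (N : ℕ) (lam R d α : ℝ) : Fin N → ℂ :=
  (Real.sqrt R : ℂ) • ((sqrtResistanceC N lam R d)⁻¹ *ᵥ steering N lam d α)

theorem sqrtResistanceC_inv_mul_self_inv {N : ℕ} {lam R d : ℝ} (hlam : 0 < lam) (hR : 0 < R)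
    (hd : 0 < d) : (R : ℂ) • ((sqrtResistanceC N lam R d)⁻¹ * (sqrtResistanceC N lam R d)⁻¹) =
      (couplingMatrix N lam R d)⁻¹.map Complex.ofReal := by
  have hC := (couplingMatrix_posDef (N := N) hlam hR hd).isUnit
  rw [map_ofReal_inv hC]
  refine (Matrix.inv_eq_left_inv ?_).symm
  have : (couplingMatrix N lam R d).map Complex.ofReal =
      (R⁻¹ : ℂ) • (sqrtResistanceC N lam R d * sqrtResistanceC N lam R d) := by
    rw [sqrtResistanceC_mul_self hlam hR hd]
    ext i j
    simp [couplingMatrix]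
  have hu := (Matrix.isUnit_iff_isUnit_det _).1 (isUnit_sqrtResistanceC (N := N) hlam hR hd)
  have hR' : (R : ℂ) ≠ 0 := by exact_mod_cast hR.ne'
  rw [this, smul_mul_smul_comm, mul_inv_cancel₀ hR', one_smul, Matrix.mul_assoc,
    Matrix.nonsing_inv_mul_cancel_left _ _ hu, Matrix.nonsing_inv_mul _ hu]

theorem whitened_dotProduct {N : ℕ} {lam R d : ℝ} (hlam : 0 < lam) (hR : 0 < R)
    (hd : 0 < d) (α β : ℝ) : star (whitened N lam R d α) ⬝ᵥ whitened N lam R d β =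
      star (steering N lam d α) ⬝ᵥ
        ((couplingMatrix N lam R d)⁻¹.map Complex.ofReal *ᵥ steering N lam d β) := by
  have hs : (Real.sqrt R : ℂ) * Real.sqrt R = R := by
    exact_mod_cast Real.mul_self_sqrt hR.le
  rw [← sqrtResistanceC_inv_mul_self_inv hlam hR hd, whitened, whitened, star_smul,
    Matrix.star_mulVec, Matrix.conjTranspose_nonsing_inv, sqrtResistanceC_conjTranspose,
    smul_dotProduct, dotProduct_smul, smul_smul, ← Matrix.dotProduct_mulVec, Matrix.mulVec_mulVec,
    Matrix.smul_mulVec, dotProduct_smul, ← starRingEnd_apply, Complex.conj_ofReal, hs]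

theorem transmitGain_eq {N : ℕ} {lam R d : ℝ} (hlam : 0 < lam) (hR : 0 < R)
    (hd : 0 < d) (α : ℝ) : transmitGain N lam R d α =
      star (whitened N lam R d α) ⬝ᵥ whitened N lam R d α :=
  (whitened_dotProduct hlam hR hd α α).symm

theorem whitened_pi_sub (N : ℕ) (lam R d α : ℝ) :
    whitened N lam R d (Real.pi - α) = star (whitened N lam R d α) := by
  have hreal : (sqrtResistanceC N lam R d)⁻¹.map star = (sqrtResistanceC N lam R d)⁻¹ := by
    have h1 : ((sqrtResistanceC N lam R d)⁻¹)ᴴ = (sqrtResistanceC N lam R d)⁻¹ := by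
      rw [Matrix.conjTranspose_nonsing_inv, sqrtResistanceC_conjTranspose]
    have h2 : ((sqrtResistanceC N lam R d)⁻¹)ᵀ = (sqrtResistanceC N lam R d)⁻¹ := by
      rw [Matrix.transpose_nonsing_inv, sqrtResistanceC_transpose]
    rw [Matrix.conjTranspose, h2] at h1
    exact h1
  have hs : star (steering N lam d α) = steering N lam d (Real.pi - α) := by
    rw [steering_eq_planeWave, steering_eq_planeWave, Real.cos_pi_sub, planeWave_neg]
  rw [whitened, whitened, ← hs]
  funext i
  simp only [Pi.smul_apply, Pi.star_apply, smul_eq_mul, star_mul', Matrix.mulVec, dotProduct,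
    star_sum]
  congr 1
  · rw [← starRingEnd_apply, Complex.conj_ofReal]
  · refine Finset.sum_congr rfl fun j _ => ?_
    congr 1
    exact (congrFun (congrFun hreal i) j).symm

/-! ### Convergence of a polar factor with graded columns -/

theorem tendsto_matrix_inv {n β : Type*} [Fintype n] [DecidableEq n] {l : Filter β}
    {A : β → Matrix n n ℂ} {A₀ : Matrix n n ℂ} (hA : Tendsto A l (𝓝 A₀)) (h₀ : IsUnit A₀) :
    Tendsto (fun x => (A x)⁻¹) l (𝓝 A₀⁻¹) := by
  have hdet : A₀.det ≠ 0 := ((Matrix.isUnit_iff_isUnit_det _).1 h₀).ne_zero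
  simp only [Matrix.inv_def, Ring.inverse_eq_inv']
  exact (((continuous_id.matrix_det.tendsto A₀).comp hA).inv₀ hdet).smul
    ((continuous_id.matrix_adjugate.tendsto A₀).comp hA)

theorem eventually_isUnit {n β : Type*} [Fintype n] [DecidableEq n] {l : Filter β}
    {A : β → Matrix n n ℂ} {A₀ : Matrix n n ℂ} (hA : Tendsto A l (𝓝 A₀)) (h₀ : IsUnit A₀) :
    ∀ᶠ x in l, IsUnit (A x) := by
  have hdet : A₀.det ≠ 0 := ((Matrix.isUnit_iff_isUnit_det _).1 h₀).ne_zero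
  filter_upwards [((continuous_id.matrix_det.tendsto A₀).comp hA).eventually_ne hdet] with x hx
  exact (Matrix.isUnit_iff_isUnit_det _).2 (isUnit_iff_ne_zero.2 hx)

open scoped ComplexOrder in
/-- Uniqueness of the Cholesky factor of `Bᴴ B`: a unitary `x` such that `B x` is lower triangular
with nonnegative diagonal is determined by `B`. -/
theorem unitary_eq_of_lowerTriangular {n : Type*} [Fintype n] [LinearOrder n]
    {B x y : Matrix n n ℂ} (hB : IsUnit B) (hx : xᴴ * x = 1) (hy : yᴴ * y = 1)
    (hxt : (B * x).BlockTriangular OrderDual.toDual) (hyt : (B * y).BlockTriangular OrderDual.toDual)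
    (hxd : ∀ i, 0 ≤ (B * x) i i) (hyd : ∀ i, 0 ≤ (B * y) i i) : x = y := by
  have hBdet := (Matrix.isUnit_iff_isUnit_det _).1 hB
  have hunit : ∀ {z : Matrix n n ℂ}, zᴴ * z = 1 → IsUnit (B * z) := fun hz =>
    hB.mul ⟨⟨_, _, mul_eq_one_comm.1 hz, hz⟩, rfl⟩
  have htri : ∀ {y z : Matrix n n ℂ}, yᴴ * y = 1 → zᴴ * z = 1 →
      (B * y).BlockTriangular OrderDual.toDual → (B * z).BlockTriangular OrderDual.toDual →
      (yᴴ * z).BlockTriangular OrderDual.toDual := by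
    intro y z hy hz hyt hzt
    have e : yᴴ * z = (B * y)⁻¹ * (B * z) := by
      rw [Matrix.mul_inv_rev, Matrix.inv_eq_left_inv hy, Matrix.mul_assoc,
        Matrix.nonsing_inv_mul_cancel_left _ _ hBdet]
    have := (hunit hy).invertible
    rw [e]
    exact (Matrix.blockTriangular_inv_of_blockTriangular hyt).mul hzt
  set L := yᴴ * x with hL
  have hL1 := htri hy hx hyt hxt
  have hL2 := htri hx hy hxt hyt
  have hLH : Lᴴ = xᴴ * y := by rw [hL, Matrix.conjTranspose_mul, Matrix.conjTranspose_conjTranspose]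
  have hdiag : ∀ i j, i ≠ j → L i j = 0 := by
    intro i j hij
    rcases lt_or_gt_of_ne hij with h | h
    · exact hL1 (OrderDual.toDual_lt_toDual.2 h)
    · have := hL2 (i := j) (j := i) (OrderDual.toDual_lt_toDual.2 h)
      rw [← hLH, Matrix.conjTranspose_apply, star_eq_zero] at this
      exact this
  have hyL : y * L = x := by
    rw [hL, ← Matrix.mul_assoc, mul_eq_one_comm.1 hy, Matrix.one_mul]
  have hLL : Lᴴ * L = 1 := by
    rw [hLH, Matrix.mul_assoc, hyL, hx]
  suffices L = 1 by rw [← hyL, this, Matrix.mul_one]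
  ext i j
  by_cases hij : i = j
  · subst hij
    rw [Matrix.one_apply_eq]
    have hne : (B * x) i i ≠ 0 := by
      have hdet := ((Matrix.isUnit_iff_isUnit_det _).1 (hunit hx)).ne_zero
      rw [Matrix.det_of_isLowerTriangular _ hxt] at hdet
      exact Finset.prod_ne_zero_iff.1 hdet i (Finset.mem_univ i)
    have hmul : (B * x) i i = (B * y) i i * L i i := by
      rw [← hyL, ← Matrix.mul_assoc, Matrix.mul_apply]
      exact Finset.sum_eq_single i (fun k _ hk => by rw [hdiag k i hk, mul_zero]) (by simp)
    have hnorm : star (L i i) * L i i = 1 := by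
      have := congrFun (congrFun hLL i) i
      rw [Matrix.mul_apply, Finset.sum_eq_single i (fun k _ hk => by rw [hdiag k i hk, mul_zero])
        (by simp), Matrix.one_apply_eq] at this
      exact this
    have h1 := hxd i
    have h2 := hyd i
    rw [Complex.nonneg_iff] at h1 h2
    set a := (B * x) i i
    set b := (B * y) i i
    have hn : ‖L i i‖ = 1 := by
      have h := congrArg norm hnorm
      rw [norm_mul, norm_star, norm_one] at h
      nlinarith [norm_nonneg (L i i)]
    have hab : a = b := by
      have : ‖a‖ = ‖b‖ := by rw [hmul, norm_mul, hn, mul_one]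
      have ha : a = (a.re : ℂ) := Complex.ext rfl (by simp [← h1.2])
      have hb : b = (b.re : ℂ) := Complex.ext rfl (by simp [← h2.2])
      rw [ha, hb, Complex.norm_real, Complex.norm_real, Real.norm_of_nonneg h1.1,
        Real.norm_of_nonneg h2.1] at this
      rw [ha, hb, this]
    rw [hab] at hmul hne
    exact (mul_eq_left₀ hne).1 hmul.symm
  · rw [hdiag i j hij, Matrix.one_apply_ne hij]

/-- The grading `diag (1, d, d², …)`. -/
noncomputable def grading (N : ℕ) (d : ℝ) : Matrix (Fin N) (Fin N) ℂ :=
  Matrix.diagonal fun m => (d : ℂ) ^ (m : ℕ)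

open scoped ComplexOrder in
/-- Let `K` be asymptotically unitary with `Vᴴ K D⁻¹` positive semidefinite, for the grading
`D = diag (1, d, d², …)` and `V` with invertible limit. Then `K` converges as `d → 0`. By the
hermitian symmetry of `Vᴴ K D⁻¹`, the entries of `Vᴴ K` above the diagonal are `O(d)`, so at every
cluster point `Vᴴ K` is lower triangular with nonnegative diagonal; there is only one such
unitary `K`. -/
theorem exists_tendsto_of_graded {N : ℕ} {V K G : ℝ → Matrix (Fin N) (Fin N) ℂ}
    {V₀ : Matrix (Fin N) (Fin N) ℂ} (hV₀ : IsUnit V₀) (hV : Tendsto V (𝓝[>] 0) (𝓝 V₀))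
    (hG : Tendsto G (𝓝[>] 0) (𝓝 1))
    (hK : ∀ᶠ d in 𝓝[>] 0, K d * G d * (K d)ᴴ = 1)
    (hpos : ∀ᶠ d in 𝓝[>] 0, ((V d)ᴴ * K d * (grading N d)⁻¹).PosSemidef) :
    ∃ K₀ : Matrix (Fin N) (Fin N) ℂ, K₀ᴴ * K₀ = 1 ∧ Tendsto K (𝓝[>] 0) (𝓝 K₀) := by
  have hKK : Tendsto (fun d => (K d)ᴴ * K d) (𝓝[>] 0) (𝓝 1) := by
    have h := tendsto_matrix_inv hG isUnit_one
    rw [inv_one] at h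
    refine h.congr' ?_
    filter_upwards [hK] with d hd
    rw [Matrix.mul_assoc] at hd
    have := mul_eq_one_comm.1 hd
    rw [Matrix.mul_assoc] at this
    exact Matrix.inv_eq_right_inv this
  set s : Set (Matrix (Fin N) (Fin N) ℂ) :=
    Set.univ.pi fun _ => Set.univ.pi fun _ => Metric.closedBall (0 : ℂ) 2 with hs
  have hsc : IsCompact s :=
    isCompact_univ_pi fun _ => isCompact_univ_pi fun _ => isCompact_closedBall _ _
  have hmem : ∀ᶠ d in 𝓝[>] 0, K d ∈ s := by
    have h : ∀ j, ∀ᶠ d in 𝓝[>] (0 : ℝ), ‖((K d)ᴴ * K d) j j‖ < 2 := by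
      intro j
      have h1 : Tendsto (fun d => ‖((K d)ᴴ * K d) j j‖) (𝓝[>] 0) (𝓝 1) := by
        simpa using (((continuous_id.matrix_elem j j).tendsto _).comp hKK).norm
      exact h1.eventually_lt_const (by norm_num)
    filter_upwards [eventually_all.2 h] with d hd
    intro i _ j _
    rw [mem_closedBall_zero_iff]
    have hj := hd j
    have e : ((K d)ᴴ * K d) j j = ((∑ k, ‖K d k j‖ ^ 2 : ℝ) : ℂ) := by
      rw [Matrix.mul_apply, Complex.ofReal_sum]
      refine Finset.sum_congr rfl fun k _ => ?_
      rw [Matrix.conjTranspose_apply, ← starRingEnd_apply, ← Complex.normSq_eq_conj_mul_self,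
        Complex.normSq_eq_norm_sq]
    have hle : ‖K d i j‖ ^ 2 ≤ ∑ k, ‖K d k j‖ ^ 2 :=
      Finset.single_le_sum (f := fun k => ‖K d k j‖ ^ 2) (fun k _ => by positivity)
        (Finset.mem_univ i)
    rw [e, Complex.norm_real, Real.norm_of_nonneg (by positivity)] at hj
    nlinarith [norm_nonneg (K d i j)]
  have hcluster : ∀ x, MapClusterPt x (𝓝[>] 0) K → xᴴ * x = 1 ∧
      (V₀ᴴ * x).BlockTriangular OrderDual.toDual ∧ ∀ i, 0 ≤ (V₀ᴴ * x) i i := by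
    intro x hx
    obtain ⟨U, hU, hxU⟩ := mapClusterPt_iff_ultrafilter.1 hx
    have hJ : Tendsto (fun d => (V d)ᴴ * K d) U (𝓝 (V₀ᴴ * x)) :=
      ((continuous_id.matrix_conjTranspose.tendsto V₀).comp (hV.mono_left hU)).mul hxU
    have hJe : ∀ i j, Tendsto (fun d => ((V d)ᴴ * K d) i j) U (𝓝 ((V₀ᴴ * x) i j)) := fun i j =>
      ((continuous_id.matrix_elem i j).tendsto _).comp hJ
    have hd0 : Tendsto (fun d : ℝ => (d : ℂ)) U (𝓝 0) := by
      have : Tendsto (fun d : ℝ => (d : ℂ)) (𝓝 0) (𝓝 ((0 : ℝ) : ℂ)) :=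
        Complex.continuous_ofReal.tendsto 0
      exact this.mono_left (hU.trans nhdsWithin_le_nhds)
    have hent : ∀ d : ℝ, 0 < d → ∀ i j, ((V d)ᴴ * K d) i j =
        ((V d)ᴴ * K d * (grading N d)⁻¹) i j * (d : ℂ) ^ (j : ℕ) := by
      intro d hd i j
      have hu : IsUnit (grading N d).det := by
        have hd' : (d : ℂ) ≠ 0 := by exact_mod_cast hd.ne'
        rw [grading, Matrix.det_diagonal, isUnit_iff_ne_zero]
        exact Finset.prod_ne_zero_iff.2 fun m _ => pow_ne_zero _ hd'
      have := congrFun (congrFun (Matrix.nonsing_inv_mul_cancel_right _ ((V d)ᴴ * K d) hu) i) j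
      rw [← this]
      nth_rewrite 2 [grading]
      rw [Matrix.mul_diagonal]
    have hev : ∀ᶠ d in (U : Filter ℝ), 0 < d := hU self_mem_nhdsWithin
    refine ⟨?_, ?_, ?_⟩
    · exact tendsto_nhds_unique
        (((continuous_id.matrix_conjTranspose.tendsto x).comp hxU).mul hxU) (hKK.mono_left hU)
    · intro i j hij
      have hij' : i < j := hij
      refine tendsto_nhds_unique (hJe i j) ?_
      have h0 : Tendsto (fun d : ℝ => star (((V d)ᴴ * K d) j i) * (d : ℂ) ^ ((j : ℕ) - (i : ℕ)))
          U (𝓝 0) := by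
        have h := ((continuous_star.tendsto _).comp (hJe j i)).mul
          (hd0.pow ((j : ℕ) - (i : ℕ)))
        rwa [zero_pow (Nat.sub_ne_zero_of_lt hij'), mul_zero] at h
      refine h0.congr' ?_
      filter_upwards [hev, hU hpos] with d hd hp
      rw [hent d hd i j, hent d hd j i, ← hp.isHermitian.apply i j, star_mul', mul_assoc]
      congr 1
      rw [star_pow, ← starRingEnd_apply, Complex.conj_ofReal, ← pow_add]
      congr 1
      have : (i : ℕ) < j := hij'
      omega
    · intro i
      refine ge_of_tendsto (hJe i i) ?_
      filter_upwards [hev, hU hpos] with d hd hp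
      rw [hent d hd i i]
      refine mul_nonneg hp.diag_nonneg ?_
      exact_mod_cast pow_nonneg hd.le _
  have hB : IsUnit V₀ᴴ := by
    rw [Matrix.isUnit_conjTranspose]
    exact hV₀
  obtain ⟨K₀, -, hK₀⟩ := hsc.exists_mapClusterPt (tendsto_principal.2 hmem)
  obtain ⟨h1, h2, h3⟩ := hcluster K₀ hK₀
  refine ⟨K₀, h1, hsc.tendsto_nhds_of_unique_mapClusterPt hmem fun x _ hx => ?_⟩
  obtain ⟨g1, g2, g3⟩ := hcluster x hx
  exact unitary_eq_of_lowerTriangular hB g1 h1 g2 h2 g3 h3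

/-! ### The limit of the whitened array vectors -/

/-- The orthonormal Legendre polynomials of degree less than `N` at `t`, the limit of the plane
waves in graded coordinates. -/
noncomputable def legendreVec (N : ℕ) (t : ℝ) : Fin N → ℂ :=
  fun l => (((legendre l).eval t : ℝ) : ℂ)

theorem star_legendreVec_dotProduct (N : ℕ) (t : ℝ) :
    star (legendreVec N t) ⬝ᵥ legendreVec N t =
      ((∑ l : Fin N, (legendre l).eval t ^ 2 : ℝ) : ℂ) := by
  simp only [dotProduct, legendreVec, Pi.star_apply, Complex.ofReal_sum]
  refine Finset.sum_congr rfl fun l _ => ?_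
  rw [← starRingEnd_apply, Complex.conj_ofReal]
  push_cast
  ring

/-- The coordinates of the Taylor monomials `(-j k d t)ᵐ / m!` in the Legendre basis, conjugated by
the grading. The subtraction `m - l` truncates only where the Legendre coefficient vanishes. -/
noncomputable def taylorLegendre (N : ℕ) (k d : ℝ) : Matrix (Fin N) (Fin N) ℂ :=
  Matrix.of fun m l => (d : ℂ) ^ ((m : ℕ) - (l : ℕ)) *
    ((-(Complex.I * k)) ^ (m : ℕ) / (Nat.factorial m : ℂ)) *
    ((polyMean (Polynomial.X ^ (m : ℕ) * legendre l) : ℝ) : ℂ)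

/-- The matrix `V` for which the plane waves are `V diag (1, d, d², …) p` up to `O(dᴺ)`, where `p`
is the vector of the Legendre polynomials. -/
noncomputable def frame (N : ℕ) (k d : ℝ) : Matrix (Fin N) (Fin N) ℂ :=
  Matrix.vandermonde (fun n : Fin N => ((n : ℕ) : ℂ)) * taylorLegendre N k d

theorem continuous_frame (N : ℕ) (k : ℝ) : Continuous (frame N k) := by
  unfold frame taylorLegendre
  refine continuous_const.mul ?_
  refine continuous_matrix fun i j => ?_
  simp only [Matrix.of_apply]
  fun_prop

theorem isUnit_frame_zero (N : ℕ) {k : ℝ} (hk : 0 < k) : IsUnit (frame N k 0) := by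
  have hk' : (k : ℂ) ≠ 0 := by exact_mod_cast hk.ne'
  rw [Matrix.isUnit_iff_isUnit_det, frame, Matrix.det_mul, isUnit_iff_ne_zero]
  refine mul_ne_zero ?_ ?_
  · rw [Matrix.det_vandermonde_ne_zero_iff]
    intro i j hij
    exact Fin.ext (Nat.cast_injective hij)
  · rw [Matrix.det_of_isLowerTriangular]
    · refine Finset.prod_ne_zero_iff.2 fun m _ => ?_
      simp only [taylorLegendre, Matrix.of_apply, Nat.sub_self, pow_zero, one_mul]
      refine mul_ne_zero (div_ne_zero (pow_ne_zero _ (neg_ne_zero.2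
        (mul_ne_zero Complex.I_ne_zero hk'))) (by exact_mod_cast Nat.factorial_ne_zero _)) ?_
      exact_mod_cast polyMean_X_pow_mul_legendre_self_ne_zero m
    · intro i j hij
      have hij' : (i : ℕ) < j := hij
      simp [taylorLegendre, polyMean_X_pow_mul_legendre_eq_zero hij']

theorem frame_mul_grading_mulVec (N : ℕ) (k d t : ℝ) (n : Fin N) :
    ((frame N k d * grading N d) *ᵥ legendreVec N t) n =
      ∑ m ∈ Finset.range N, (-(Complex.I * (k * d : ℝ) * t) * n) ^ m / (Nat.factorial m : ℂ) := by
  have hT : ∀ m : Fin N, ((taylorLegendre N k d * grading N d) *ᵥ legendreVec N t) m =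
      (-(Complex.I * k) * d * t) ^ (m : ℕ) / (Nat.factorial m : ℂ) := by
    intro m
    have hexp := eq_sum_legendre (N := N) (q := Polynomial.X ^ (m : ℕ))
      (by rw [Polynomial.degree_X_pow]; exact_mod_cast m.2)
    have hev := congrArg (Polynomial.eval t) hexp
    rw [Polynomial.eval_pow, Polynomial.eval_X, Polynomial.eval_finsetSum,
      ← Fin.sum_univ_eq_sum_range (fun l =>
        (polyMean (Polynomial.X ^ (m : ℕ) * legendre l) • legendre l).eval t)] at hev
    have hevc : (t : ℂ) ^ (m : ℕ) = ∑ l : Fin N,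
        ((polyMean (Polynomial.X ^ (m : ℕ) * legendre l) : ℝ) : ℂ) * legendreVec N t l := by
      rw [← Complex.ofReal_pow, hev, Complex.ofReal_sum]
      simp [legendreVec]
    rw [mul_pow, mul_pow, hevc, Finset.mul_sum, Finset.sum_div, grading, Matrix.mulVec,
      dotProduct]
    refine Finset.sum_congr rfl fun l _ => ?_
    rw [Matrix.mul_diagonal, taylorLegendre, Matrix.of_apply]
    rcases le_or_gt (l : ℕ) m with h | h
    · rw [← Nat.sub_add_cancel h, pow_add (d : ℂ), Nat.sub_add_cancel h]
      ring
    · simp [polyMean_X_pow_mul_legendre_eq_zero h]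
  rw [frame, Matrix.mul_assoc, ← Matrix.mulVec_mulVec, Matrix.mulVec, dotProduct,
    ← Fin.sum_univ_eq_sum_range (fun m =>
      (-(Complex.I * (k * d : ℝ) * t) * n) ^ m / (Nat.factorial m : ℂ))]
  refine Finset.sum_congr rfl fun m _ => ?_
  rw [hT, Matrix.vandermonde_apply]
  push_cast
  have : -(Complex.I * (k * d) * t) * ((n : ℕ) : ℂ) = (-(Complex.I * k) * d * t) * n := by ring
  rw [this, mul_pow _ ((n : ℕ) : ℂ)]
  ring

theorem isUnit_grading (N : ℕ) {d : ℝ} (hd : 0 < d) : IsUnit (grading N d) := by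
  have hd' : (d : ℂ) ≠ 0 := by exact_mod_cast hd.ne'
  rw [Matrix.isUnit_iff_isUnit_det, grading, Matrix.det_diagonal, isUnit_iff_ne_zero]
  exact Finset.prod_ne_zero_iff.2 fun m _ => pow_ne_zero _ hd'

theorem norm_planeWave_sub_le {N : ℕ} {k d t : ℝ} (hk : 0 < k) (hd : 0 < d) (hd1 : d ≤ 1)
    (ht : t ∈ Set.Icc (-1 : ℝ) 1) (n : Fin N) :
    ‖planeWave N (k * d) t n - ((frame N k d * grading N d) *ᵥ legendreVec N t) n‖ ≤
      (k * N) ^ N * Real.exp (k * N) * d ^ N := by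
  rw [frame_mul_grading_mulVec, planeWave]
  refine (Complex.norm_exp_sub_sum_le_norm_mul_exp _ N).trans ?_
  have hn : ((n : ℕ) : ℝ) ≤ N := by exact_mod_cast n.2.le
  have ht' : |t| ≤ 1 := abs_le.2 ht
  have hx : ‖-(Complex.I * ((k * d : ℝ) : ℂ) * t) * ((n : ℕ) : ℂ)‖ ≤ k * N * d := by
    rw [norm_mul, norm_neg, norm_mul, norm_mul, Complex.norm_I, Complex.norm_real,
      Complex.norm_real, Complex.norm_natCast, Real.norm_of_nonneg (by positivity), Real.norm_eq_abs,
      one_mul]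
    calc k * d * |t| * (n : ℕ) ≤ k * d * 1 * N := by gcongr
      _ = k * N * d := by ring
  calc _ ≤ (k * N * d) ^ N * Real.exp (k * N * 1) := by
        gcongr
        exact hx.trans (by gcongr)
    _ = _ := by rw [mul_one, mul_pow]; ring

/-- The plane waves in graded coordinates. -/
noncomputable def gradedWave (N : ℕ) (k d t : ℝ) : Fin N → ℂ :=
  (frame N k d * grading N d)⁻¹ *ᵥ planeWave N (k * d) t

theorem continuous_gradedWave (N : ℕ) (k d : ℝ) (m : Fin N) :
    Continuous fun t => gradedWave N k d t m := by
  unfold gradedWave Matrix.mulVec dotProduct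
  exact continuous_finsetSum _ fun i _ => continuous_const.mul (continuous_planeWave N _ i)

theorem eventually_isUnit_frame (N : ℕ) {k : ℝ} (hk : 0 < k) :
    ∀ᶠ d in 𝓝[>] 0, IsUnit (frame N k d) :=
  eventually_isUnit (((continuous_frame N k).tendsto 0).mono_left nhdsWithin_le_nhds)
    (isUnit_frame_zero N hk)

/-- In graded coordinates the plane waves converge to the Legendre polynomials, uniformly on
`[-1, 1]`. -/
theorem eventually_gradedWave_sub_le (N : ℕ) {k : ℝ} (hk : 0 < k) {ε : ℝ} (hε : 0 < ε) :
    ∀ᶠ d in 𝓝[>] 0, ∀ t ∈ Set.Icc (-1 : ℝ) 1, ∀ m : Fin N,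
      ‖gradedWave N k d t m - legendreVec N t m‖ ≤ ε := by
  have hV := ((continuous_frame N k).tendsto 0).mono_left (nhdsWithin_le_nhds (s := Set.Ioi 0))
  have hVinv := tendsto_matrix_inv hV (isUnit_frame_zero N hk)
  have hd0 : Tendsto (fun d : ℝ => d) (𝓝[>] 0) (𝓝 0) := nhdsWithin_le_nhds
  have hsmall : Tendsto (fun d => (∑ i, ∑ j, ‖(frame N k d)⁻¹ i j‖) *
      ((k * N) ^ N * Real.exp (k * N)) * d) (𝓝[>] 0) (𝓝 0) := by
    have h := ((tendsto_finsetSum Finset.univ fun i _ => tendsto_finsetSum Finset.univ fun j _ =>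
      (((continuous_id.matrix_elem i j).tendsto _).comp hVinv).norm).mul_const
      ((k * N) ^ N * Real.exp (k * N))).mul hd0
    rw [mul_zero] at h
    exact h
  filter_upwards [eventually_isUnit_frame N hk, self_mem_nhdsWithin,
    hsmall.eventually_lt_const hε, hd0.eventually_lt_const one_pos] with d hu hd hle hd1 t ht m
  have hd : 0 < d := hd
  have hdC : (d : ℂ) ≠ 0 := by exact_mod_cast hd.ne'
  have hQ : IsUnit (frame N k d * grading N d) := hu.mul (isUnit_grading N hd)
  set ρ : Fin N → ℂ :=
    planeWave N (k * d) t - (frame N k d * grading N d) *ᵥ legendreVec N t with hρ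
  have e : gradedWave N k d t - legendreVec N t = (grading N d)⁻¹ *ᵥ ((frame N k d)⁻¹ *ᵥ ρ) := by
    rw [Matrix.mulVec_mulVec, ← Matrix.mul_inv_rev, hρ, Matrix.mulVec_sub, Matrix.mulVec_mulVec,
      Matrix.nonsing_inv_mul _ ((Matrix.isUnit_iff_isUnit_det _).1 hQ), Matrix.one_mulVec,
      gradedWave]
  have hgr : (grading N d)⁻¹ = Matrix.diagonal fun m : Fin N => ((d : ℂ) ^ (m : ℕ))⁻¹ := by
    refine Matrix.inv_eq_left_inv ?_
    rw [grading, Matrix.diagonal_mul_diagonal, ← Matrix.diagonal_one]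
    congr 1
    funext m
    exact inv_mul_cancel₀ (pow_ne_zero _ hdC)
  have e2 := congrFun e m
  rw [hgr, Matrix.mulVec_diagonal, Pi.sub_apply] at e2
  rw [e2, norm_mul, norm_inv, norm_pow, Complex.norm_real, Real.norm_of_nonneg hd.le]
  have hvec : ‖((frame N k d)⁻¹ *ᵥ ρ) m‖ ≤ (∑ i, ∑ j, ‖(frame N k d)⁻¹ i j‖) *
      ((k * N) ^ N * Real.exp (k * N) * d ^ N) := by
    rw [Matrix.mulVec, dotProduct]
    refine (norm_sum_le _ _).trans ?_
    calc ∑ j, ‖(frame N k d)⁻¹ m j * ρ j‖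
        ≤ ∑ j, ‖(frame N k d)⁻¹ m j‖ * ((k * N) ^ N * Real.exp (k * N) * d ^ N) := by
          refine Finset.sum_le_sum fun j _ => ?_
          rw [norm_mul]
          gcongr
          exact norm_planeWave_sub_le hk hd hd1.le ht j
      _ ≤ _ := by
          rw [← Finset.sum_mul]
          refine mul_le_mul_of_nonneg_right ?_ (by positivity)
          exact Finset.single_le_sum (f := fun i => ∑ j, ‖(frame N k d)⁻¹ i j‖)
            (fun i _ => Finset.sum_nonneg fun j _ => norm_nonneg _) (Finset.mem_univ m)
  have hpow : (d ^ (m : ℕ))⁻¹ * d ^ N ≤ d := by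
    have hN : d ^ N = d ^ (N - m) * d ^ (m : ℕ) := by
      rw [← pow_add, Nat.sub_add_cancel m.2.le]
    rw [hN, mul_comm, mul_assoc, mul_inv_cancel₀ (pow_ne_zero _ hd.ne'), mul_one]
    exact pow_le_of_le_one hd.le hd1.le (Nat.sub_ne_zero_of_lt m.2)
  have hB : 0 ≤ (∑ i, ∑ j, ‖(frame N k d)⁻¹ i j‖) * ((k * N) ^ N * Real.exp (k * N)) := by
    have : 0 ≤ ∑ i, ∑ j, ‖(frame N k d)⁻¹ i j‖ :=
      Finset.sum_nonneg fun i _ => Finset.sum_nonneg fun j _ => norm_nonneg _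
    positivity
  calc _ ≤ (d ^ (m : ℕ))⁻¹ * ((∑ i, ∑ j, ‖(frame N k d)⁻¹ i j‖) *
      ((k * N) ^ N * Real.exp (k * N) * d ^ N)) := by gcongr
    _ = (∑ i, ∑ j, ‖(frame N k d)⁻¹ i j‖) * ((k * N) ^ N * Real.exp (k * N)) *
        ((d ^ (m : ℕ))⁻¹ * d ^ N) := by ring
    _ ≤ (∑ i, ∑ j, ‖(frame N k d)⁻¹ i j‖) * ((k * N) ^ N * Real.exp (k * N)) * d := by gcongr
    _ ≤ ε := hle.le

theorem tendsto_gradedWave (N : ℕ) {k : ℝ} (hk : 0 < k) {t : ℝ} (ht : t ∈ Set.Icc (-1 : ℝ) 1) :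
    Tendsto (fun d => gradedWave N k d t) (𝓝[>] 0) (𝓝 (legendreVec N t)) := by
  rw [tendsto_pi_nhds]
  intro m
  rw [Metric.tendsto_nhds]
  intro ε hε
  filter_upwards [eventually_gradedWave_sub_le N hk (half_pos hε)] with d hd
  rw [dist_eq_norm]
  exact (hd t ht m).trans_lt (half_lt_self hε)

/-- The Gram matrix of the plane waves in graded coordinates. -/
noncomputable def gradedGram (N : ℕ) (k d : ℝ) : Matrix (Fin N) (Fin N) ℂ :=
  Matrix.of fun i j => 1 / 2 * ∫ t in (-1 : ℝ)..1,
    gradedWave N k d t i * star (gradedWave N k d t j)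

theorem tendsto_gradedGram (N : ℕ) {k : ℝ} (hk : 0 < k) :
    Tendsto (gradedGram N k) (𝓝[>] 0) (𝓝 1) := by
  refine tendsto_pi_nhds.2 fun i => tendsto_pi_nhds.2 fun j => ?_
  have hlim : (1 : Matrix (Fin N) (Fin N) ℂ) i j = 1 / 2 * ∫ t in (-1 : ℝ)..1,
      legendreVec N t i * star (legendreVec N t j) := by
    have h1 : ∀ t, legendreVec N t i * star (legendreVec N t j) =
        (((legendre i * legendre j).eval t : ℝ) : ℂ) := by
      intro t
      simp [legendreVec]
    simp_rw [h1]
    rw [intervalIntegral.integral_ofReal]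
    have := polyMean_legendre_mul_legendre i j
    rw [polyMean_apply] at this
    rw [Matrix.one_apply]
    simp only [Fin.ext_iff]
    have h2 := congrArg Complex.ofReal this
    rw [Complex.ofReal_mul, apply_ite Complex.ofReal, Complex.ofReal_one,
      Complex.ofReal_zero] at h2
    rw [← h2]
    push_cast
    rfl
  rw [hlim]
  simp only [gradedGram, Matrix.of_apply]
  refine Tendsto.const_mul _ ?_
  have hIcc : ∀ t ∈ Set.uIoc (-1 : ℝ) 1, t ∈ Set.Icc (-1 : ℝ) 1 := by
    intro t ht
    rw [Set.uIoc_of_le (by norm_num)] at ht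
    exact ⟨ht.1.le, ht.2⟩
  have hleg : ∀ t ∈ Set.Icc (-1 : ℝ) 1, ∀ l : Fin N, ‖legendreVec N t l‖ ≤ 2 * l + 1 := by
    intro t ht l
    rw [legendreVec, Complex.norm_real, Real.norm_eq_abs]
    have h1 := legendre_eval_sq_le l ht
    refine abs_le_of_sq_le_sq (h1.trans ?_) (by positivity)
    have : (0 : ℝ) ≤ (l : ℕ) := by positivity
    nlinarith
  refine intervalIntegral.tendsto_integral_filter_of_dominated_convergence
    (fun _ => (2 * (i : ℝ) + 1 + 1) * (2 * (j : ℝ) + 1 + 1)) ?_ ?_ ?_ ?_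
  · refine Eventually.of_forall fun d => Continuous.aestronglyMeasurable ?_
    exact (continuous_gradedWave N k d i).mul (continuous_gradedWave N k d j).star
  · filter_upwards [eventually_gradedWave_sub_le N hk one_pos] with d hd
    refine MeasureTheory.ae_of_all _ fun t ht => ?_
    have hb : ∀ l : Fin N, ‖gradedWave N k d t l‖ ≤ 2 * l + 1 + 1 := by
      intro l
      have h1 := hd t (hIcc t ht) l
      have h2 := hleg t (hIcc t ht) l
      have h3 := norm_add_le (legendreVec N t l) (gradedWave N k d t l - legendreVec N t l)
      rw [add_sub_cancel] at h3
      linarith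
    rw [norm_mul, norm_star]
    exact mul_le_mul (hb i) (hb j) (norm_nonneg _) (by positivity)
  · exact intervalIntegrable_const
  · refine MeasureTheory.ae_of_all _ fun t ht => ?_
    have h := tendsto_pi_nhds.1 (tendsto_gradedWave N hk (hIcc t ht))
    exact (h i).mul ((continuous_star.tendsto _).comp (h j))

theorem couplingMatrix_eq_mul_gradedGram_mul {N : ℕ} {lam R d : ℝ} (hlam : 0 < lam) (hR : 0 < R)
    (hd : 0 < d) (hu : IsUnit (frame N (waveNumber lam) d)) :
    (couplingMatrix N lam R d).map Complex.ofReal =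
      frame N (waveNumber lam) d * grading N d * gradedGram N (waveNumber lam) d *
        (frame N (waveNumber lam) d * grading N d)ᴴ := by
  set Q := frame N (waveNumber lam) d * grading N d with hQ
  have hQu : IsUnit Q := hu.mul (isUnit_grading N hd)
  have hw : ∀ t, planeWave N (waveNumber lam * d) t = Q *ᵥ gradedWave N (waveNumber lam) d t := by
    intro t
    rw [gradedWave, Matrix.mulVec_mulVec, ← hQ,
      Matrix.mul_nonsing_inv _ ((Matrix.isUnit_iff_isUnit_det _).1 hQu), Matrix.one_mulVec]
  ext i j
  rw [Matrix.map_apply, couplingMatrix_eq_integral hlam hR hd]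
  have h1 : ∀ t, planeWave N (waveNumber lam * d) t i *
      star (planeWave N (waveNumber lam * d) t j) = ∑ b, ∑ a, Q i a * star (Q j b) *
        (gradedWave N (waveNumber lam) d t a * star (gradedWave N (waveNumber lam) d t b)) := by
    intro t
    rw [hw, Matrix.mulVec, Matrix.mulVec, dotProduct, dotProduct, star_sum, Finset.sum_mul_sum,
      Finset.sum_comm]
    refine Finset.sum_congr rfl fun a _ => Finset.sum_congr rfl fun b _ => ?_
    rw [star_mul']
    ring
  have hc : ∀ a b, Continuous fun t => Q i a * star (Q j b) *
      (gradedWave N (waveNumber lam) d t a * star (gradedWave N (waveNumber lam) d t b)) :=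
    fun a b => continuous_const.mul
      ((continuous_gradedWave N _ d a).mul (continuous_gradedWave N _ d b).star)
  simp_rw [h1]
  rw [intervalIntegral.integral_finsetSum fun b _ =>
    (continuous_finsetSum _ fun a _ => hc a b).intervalIntegrable _ _, Finset.mul_sum,
    Matrix.mul_apply]
  refine Finset.sum_congr rfl fun b _ => ?_
  rw [intervalIntegral.integral_finsetSum fun a _ => (hc a b).intervalIntegrable _ _,
    Finset.mul_sum, Matrix.mul_apply, Finset.sum_mul]
  refine Finset.sum_congr rfl fun a _ => ?_
  rw [intervalIntegral.integral_const_mul, gradedGram, Matrix.of_apply, Matrix.conjTranspose_apply]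
  ring

open scoped ComplexOrder MatrixOrder in
theorem sqrtResistanceC_posSemidef (N : ℕ) (lam R d : ℝ) :
    (sqrtResistanceC N lam R d).PosSemidef := by
  obtain ⟨B, hB⟩ : ∃ B : Matrix (Fin N) (Fin N) ℝ, sqrtResistance N lam R d = Bᴴ * B :=
    CStarAlgebra.nonneg_iff_eq_star_mul_self.1 (sqrtResistance_posSemidef N lam R d).nonneg
  have : sqrtResistanceC N lam R d = (B.map Complex.ofReal)ᴴ * B.map Complex.ofReal := by
    rw [sqrtResistanceC, hB, map_ofReal_mul]
    congr 1
    ext i j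
    simp
  rw [this]
  exact Matrix.posSemidef_conjTranspose_mul_self _

open scoped ComplexOrder in
/-- The whitened array vectors converge as the spacing tends to zero, up to a unitary matrix to the
vectors of the orthonormal Legendre polynomials at `cos α`. -/
theorem exists_tendsto_whitened (N : ℕ) {lam R : ℝ} (hlam : 0 < lam) (hR : 0 < R) :
    ∃ K₀ : Matrix (Fin N) (Fin N) ℂ, K₀ᴴ * K₀ = 1 ∧ ∀ α,
      Tendsto (fun d => whitened N lam R d α) (𝓝[>] 0)
        (𝓝 (K₀ *ᵥ legendreVec N (Real.cos α))) := by
  have hk : 0 < waveNumber lam := by unfold waveNumber; positivity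
  set k := waveNumber lam with hkdef
  set K : ℝ → Matrix (Fin N) (Fin N) ℂ := fun d =>
    (Real.sqrt R : ℂ) • ((sqrtResistanceC N lam R d)⁻¹ * (frame N k d * grading N d)) with hK
  have hs : (Real.sqrt R : ℂ) * Real.sqrt R = R := by
    exact_mod_cast Real.mul_self_sqrt hR.le
  obtain ⟨K₀, hK₀, hlim⟩ := exists_tendsto_of_graded (K := K) (isUnit_frame_zero N hk)
    (((continuous_frame N k).tendsto 0).mono_left nhdsWithin_le_nhds) (tendsto_gradedGram N hk)
    (by
      filter_upwards [eventually_isUnit_frame N hk, self_mem_nhdsWithin] with d hu hd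
      have hd : 0 < d := hd
      have hSu := (Matrix.isUnit_iff_isUnit_det _).1 (isUnit_sqrtResistanceC (N := N) hlam hR hd)
      have hC := couplingMatrix_eq_mul_gradedGram_mul hlam hR hd hu
      have hres : (R : ℂ) • (couplingMatrix N lam R d).map Complex.ofReal =
          sqrtResistanceC N lam R d * sqrtResistanceC N lam R d := by
        rw [sqrtResistanceC_mul_self hlam hR hd, resistance_eq_smul hR]
        ext i j
        simp
      have hsR : star (Real.sqrt R : ℂ) = Real.sqrt R := by
        rw [← starRingEnd_apply, Complex.conj_ofReal]
      calc K d * gradedGram N k d * (K d)ᴴ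
          = (sqrtResistanceC N lam R d)⁻¹ * ((R : ℂ) • (frame N k d * grading N d *
            gradedGram N k d * (frame N k d * grading N d)ᴴ)) * (sqrtResistanceC N lam R d)⁻¹ := by
            simp only [hK]
            rw [Matrix.conjTranspose_smul, Matrix.conjTranspose_mul _ (frame N k d * grading N d),
              Matrix.conjTranspose_nonsing_inv, sqrtResistanceC_conjTranspose, hsR]
            simp only [Matrix.smul_mul, Matrix.mul_smul, smul_smul, hs, Matrix.mul_assoc]
        _ = 1 := by
            rw [← hC, hres, Matrix.nonsing_inv_mul_cancel_left _ _ hSu,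
              Matrix.mul_nonsing_inv _ hSu])
    (by
      filter_upwards [self_mem_nhdsWithin] with d hd
      have hd : 0 < d := hd
      have hDu := (Matrix.isUnit_iff_isUnit_det _).1 (isUnit_grading N hd)
      have e : (frame N k d)ᴴ * K d * (grading N d)⁻¹ = (Real.sqrt R : ℂ) •
          ((frame N k d)ᴴ * (sqrtResistanceC N lam R d)⁻¹ * frame N k d) := by
        simp only [hK, Matrix.smul_mul, Matrix.mul_smul]
        rw [← Matrix.mul_assoc, ← Matrix.mul_assoc, Matrix.mul_nonsing_inv_cancel_right _ _ hDu]
      rw [e]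
      exact ((sqrtResistanceC_posSemidef N lam R d).inv.conjTranspose_mul_mul_same _).smul
        (by exact_mod_cast Real.sqrt_nonneg R))
  refine ⟨K₀, hK₀, fun α => ?_⟩
  have hw := tendsto_gradedWave N hk ⟨Real.neg_one_le_cos α, Real.cos_le_one α⟩
  have hmv : Continuous fun q : Matrix (Fin N) (Fin N) ℂ × (Fin N → ℂ) => q.1 *ᵥ q.2 :=
    continuous_fst.matrix_mulVec continuous_snd
  refine ((hmv.tendsto (K₀, legendreVec N (Real.cos α))).comp (hlim.prodMk_nhds hw)).congr' ?_
  filter_upwards [eventually_isUnit_frame N hk, self_mem_nhdsWithin] with d hu hd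
  have hQu := (Matrix.isUnit_iff_isUnit_det _).1 (hu.mul (isUnit_grading N hd))
  simp only [Function.comp, hK, gradedWave]
  rw [Matrix.smul_mulVec, ← Matrix.mulVec_mulVec _ (sqrtResistanceC N lam R d)⁻¹,
    Matrix.mulVec_mulVec _ (frame N k d * grading N d), Matrix.mul_nonsing_inv _ hQu, Matrix.one_mulVec, whitened,
    steering_eq_planeWave]

theorem unitary_star_mulVec_dotProduct {n : Type*} [Fintype n] [DecidableEq n] {K : Matrix n n ℂ}
    (hK : Kᴴ * K = 1) (v : n → ℂ) : star (K *ᵥ v) ⬝ᵥ (K *ᵥ v) = star v ⬝ᵥ v := by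
  rw [Matrix.star_mulVec, ← Matrix.dotProduct_mulVec, Matrix.mulVec_mulVec, hK, Matrix.one_mulVec]

/-! ### Optimal lossless loads -/

section Response

variable {n : Type*} [Fintype n]

/-- The Euclidean norm of a complex vector. -/
noncomputable def l2norm (v : n → ℂ) : ℝ := ‖WithLp.toLp 2 v‖

theorem l2norm_nonneg (v : n → ℂ) : 0 ≤ l2norm v := norm_nonneg _

theorem continuous_l2norm : Continuous (l2norm : (n → ℂ) → ℝ) :=
  continuous_norm.comp (PiLp.continuous_toLp 2 _)

theorem l2norm_sq (v : n → ℂ) : l2norm v ^ 2 = ∑ i, ‖v i‖ ^ 2 := by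
  rw [l2norm, EuclideanSpace.norm_sq_eq]

theorem l2norm_star (v : n → ℂ) : l2norm (star v) = l2norm v := by
  rw [← sq_eq_sq₀ (l2norm_nonneg _) (l2norm_nonneg _), l2norm_sq, l2norm_sq]
  simp

theorem star_dotProduct_self (v : n → ℂ) : star v ⬝ᵥ v = ((l2norm v ^ 2 : ℝ) : ℂ) := by
  rw [l2norm_sq, dotProduct, Complex.ofReal_sum]
  refine Finset.sum_congr rfl fun i _ => ?_
  rw [Pi.star_apply, ← starRingEnd_apply, ← Complex.normSq_eq_conj_mul_self,
    Complex.normSq_eq_norm_sq]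

theorem l2norm_eq_of_dotProduct {v w : n → ℂ} (h : star v ⬝ᵥ v = star w ⬝ᵥ w) :
    l2norm v = l2norm w := by
  rw [star_dotProduct_self, star_dotProduct_self, Complex.ofReal_inj] at h
  exact (sq_eq_sq₀ (l2norm_nonneg _) (l2norm_nonneg _)).1 h

theorem sum_norm_mul_le (u v : n → ℂ) : ∑ i, ‖u i * v i‖ ≤ l2norm u * l2norm v := by
  refine abs_le_of_sq_le_sq' ?_ (mul_nonneg (l2norm_nonneg u) (l2norm_nonneg v)) |>.2
  rw [mul_pow, l2norm_sq, l2norm_sq]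
  simp only [norm_mul]
  exact Finset.sum_mul_sq_le_sq_mul_sq _ _ _

theorem norm_dotProduct_le_sum (u v : n → ℂ) : ‖u ⬝ᵥ v‖ ≤ ∑ i, ‖u i * v i‖ := norm_sum_le _ _

theorem norm_dotProduct_le (u v : n → ℂ) : ‖u ⬝ᵥ v‖ ≤ l2norm u * l2norm v :=
  (norm_dotProduct_le_sum u v).trans (sum_norm_mul_le u v)

/-- The optimal normalized channel magnitude over all reciprocal lossless loads. -/
noncomputable def boundFull (u v : n → ℂ) : ℝ := 1 / 2 * (‖u ⬝ᵥ v‖ + l2norm u * l2norm v)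

/-- The optimal normalized channel magnitude over all diagonal lossless loads. -/
noncomputable def boundDiag (u v : n → ℂ) : ℝ := 1 / 2 * (‖u ⬝ᵥ v‖ + ∑ i, ‖u i * v i‖)

theorem boundFull_nonneg (u v : n → ℂ) : 0 ≤ boundFull u v := by
  have := l2norm_nonneg u
  have := l2norm_nonneg v
  unfold boundFull
  positivity

theorem boundDiag_nonneg (u v : n → ℂ) : 0 ≤ boundDiag u v := by
  unfold boundDiag
  positivity

theorem boundDiag_le_boundFull (u v : n → ℂ) : boundDiag u v ≤ boundFull u v := by
  unfold boundDiag boundFull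
  linarith [sum_norm_mul_le u v]

theorem boundFull_le (u v : n → ℂ) : boundFull u v ≤ l2norm u * l2norm v := by
  unfold boundFull
  linarith [norm_dotProduct_le u v]

theorem boundFull_star_self (v : n → ℂ) : boundFull (star v) v = l2norm v ^ 2 := by
  rw [boundFull, l2norm_star, star_dotProduct_self, Complex.norm_real,
    Real.norm_of_nonneg (by positivity)]
  ring

theorem boundDiag_star_self (v : n → ℂ) : boundDiag (star v) v = l2norm v ^ 2 := by
  rw [boundDiag, star_dotProduct_self, Complex.norm_real,
    Real.norm_of_nonneg (by positivity), l2norm_sq]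
  have : ∀ i, ‖star v i * v i‖ = ‖v i‖ ^ 2 := fun i => by
    rw [norm_mul, Pi.star_apply, norm_star, sq]
  simp only [this]
  ring

theorem conjTranspose_lossless {m : Type*} {W : Matrix m m ℝ} (hW : W.IsSymm) :
    (lossless W)ᴴ = -lossless W := by
  ext i j
  simp [lossless, hW.apply i j]

variable [DecidableEq n]

/-- The normalized channel `uᵀ (1 + j W)⁻¹ v` through a lossless load. -/
noncomputable def response (u v : n → ℂ) (W : Matrix n n ℝ) : ℂ :=
  u ⬝ᵥ ((1 + lossless W)⁻¹ *ᵥ v)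

open scoped ComplexOrder in
theorem isUnit_one_add_lossless {W : Matrix n n ℝ} (hW : W.IsSymm) :
    IsUnit (1 + lossless W) := by
  have h : (1 + lossless W)ᴴ * (1 + lossless W) = 1 + (lossless W)ᴴ * lossless W := by
    rw [Matrix.conjTranspose_add, Matrix.conjTranspose_one, conjTranspose_lossless hW]
    noncomm_ring
  have hpd : ((1 + lossless W)ᴴ * (1 + lossless W)).PosDef := by
    rw [h]
    exact Matrix.PosDef.one.add_posSemidef (Matrix.posSemidef_conjTranspose_mul_self _)
  have := (Matrix.isUnit_iff_isUnit_det _).1 hpd.isUnit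
  rw [Matrix.det_mul] at this
  exact (Matrix.isUnit_iff_isUnit_det _).2 (isUnit_of_mul_isUnit_right this)

/-- The scattering matrix `2 (1 + j W)⁻¹ - 1` of a reciprocal lossless load is unitary, which
bounds the response. -/
theorem norm_response_le_boundFull (u v : n → ℂ) {W : Matrix n n ℝ} (hW : W.IsSymm) :
    ‖response u v W‖ ≤ boundFull u v := by
  set M := 1 + lossless W with hM
  have hMu := (Matrix.isUnit_iff_isUnit_det _).1 (isUnit_one_add_lossless hW)
  have hMH : Mᴴ = 1 - lossless W := by
    rw [hM, Matrix.conjTranspose_add, Matrix.conjTranspose_one, conjTranspose_lossless hW,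
      sub_eq_add_neg]
  obtain ⟨y, hy⟩ : ∃ y, y = M⁻¹ *ᵥ v := ⟨_, rfl⟩
  have hv : v = M *ᵥ y := by
    rw [hy, Matrix.mulVec_mulVec, Matrix.mul_nonsing_inv _ hMu, Matrix.one_mulVec]
  set r := Mᴴ *ᵥ y with hr
  have hnormal : M * Mᴴ = Mᴴ * M := by
    rw [hMH, hM]
    noncomm_ring
  have hnorm : l2norm r = l2norm v := by
    apply l2norm_eq_of_dotProduct
    rw [hr, hv, Matrix.star_mulVec, Matrix.star_mulVec, ← Matrix.dotProduct_mulVec,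
      ← Matrix.dotProduct_mulVec, Matrix.mulVec_mulVec, Matrix.mulVec_mulVec,
      Matrix.conjTranspose_conjTranspose, hnormal]
  have hsum : (2 : ℂ) • y = v + r := by
    nth_rewrite 1 [hv]
    rw [hr, hMH, hM, ← Matrix.add_mulVec, add_add_sub_cancel, Matrix.add_mulVec,
      Matrix.one_mulVec, two_smul]
  have hresp : (2 : ℂ) * response u v W = u ⬝ᵥ v + u ⬝ᵥ r := by
    rw [← dotProduct_add, ← hsum, dotProduct_smul, smul_eq_mul, hy]
    rfl
  have h2 : 2 * ‖response u v W‖ ≤ ‖u ⬝ᵥ v‖ + l2norm u * l2norm v := by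
    have := congrArg norm hresp
    rw [norm_mul, Complex.norm_ofNat] at this
    rw [this, ← hnorm]
    exact (norm_add_le _ _).trans (add_le_add le_rfl (norm_dotProduct_le u r))
  unfold boundFull
  linarith

theorem one_add_lossless_diagonal_inv (x : n → ℝ) :
    (1 + lossless (Matrix.diagonal x))⁻¹ = Matrix.diagonal fun i => (1 + Complex.I * x i)⁻¹ := by
  have hne : ∀ i, 1 + Complex.I * (x i : ℂ) ≠ 0 := by
    intro i h
    have := congrArg Complex.re h
    simp at this
  refine Matrix.inv_eq_left_inv ?_
  have : 1 + lossless (Matrix.diagonal x) = Matrix.diagonal fun i => 1 + Complex.I * (x i : ℂ) := by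
    rw [lossless, Matrix.diagonal_map Complex.ofReal_zero, ← Matrix.diagonal_smul,
      ← Matrix.diagonal_one, Matrix.diagonal_add]
    rfl
  rw [this, Matrix.diagonal_mul_diagonal, ← Matrix.diagonal_one]
  congr 1
  funext i
  exact inv_mul_cancel₀ (hne i)

theorem norm_response_le_boundDiag (u v : n → ℂ) (x : n → ℝ) :
    ‖response u v (Matrix.diagonal x)‖ ≤ boundDiag u v := by
  have hterm : ∀ i, ‖2 * (1 + Complex.I * (x i : ℂ))⁻¹ - 1‖ = 1 := by
    intro i
    have hne : 1 + Complex.I * (x i : ℂ) ≠ 0 := by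
      intro h
      have := congrArg Complex.re h
      simp at this
    have e : 2 * (1 + Complex.I * (x i : ℂ))⁻¹ - 1 =
        star (1 + Complex.I * (x i : ℂ)) / (1 + Complex.I * (x i : ℂ)) := by
      have hs : star (1 + Complex.I * (x i : ℂ)) = 1 - Complex.I * x i := by
        simp [sub_eq_add_neg]
      rw [hs]
      field_simp
      ring
    rw [e, norm_div, norm_star, div_self (norm_ne_zero_iff.2 hne)]
  have hresp : 2 * response u v (Matrix.diagonal x) = u ⬝ᵥ v +
      ∑ i, u i * v i * (2 * (1 + Complex.I * (x i : ℂ))⁻¹ - 1) := by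
    rw [response, one_add_lossless_diagonal_inv, dotProduct, dotProduct, Finset.mul_sum,
      ← Finset.sum_add_distrib]
    refine Finset.sum_congr rfl fun i _ => ?_
    rw [Matrix.mulVec_diagonal]
    ring
  have h2 : 2 * ‖response u v (Matrix.diagonal x)‖ ≤ ‖u ⬝ᵥ v‖ + ∑ i, ‖u i * v i‖ := by
    have := congrArg norm hresp
    rw [norm_mul, Complex.norm_ofNat] at this
    rw [this]
    refine (norm_add_le _ _).trans (add_le_add le_rfl ((norm_sum_le _ _).trans ?_))
    refine Finset.sum_le_sum fun i _ => ?_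
    rw [norm_mul _ (2 * _ - 1), hterm, mul_one]
  unfold boundDiag
  linarith

/-- Cayley transform: a symmetric unitary matrix `U` without the eigenvalues `± 1` is the
scattering matrix of an invertible reciprocal lossless load, which is diagonal if `U` is. -/
theorem exists_load_of_symmetric_unitary {U : Matrix n n ℂ} (hsymm : Uᵀ = U) (hU : Uᴴ * U = 1)
    (hp : IsUnit (1 + U)) (hm : IsUnit (1 - U)) :
    ∃ X : Matrix n n ℝ, X.IsSymm ∧ IsUnit X ∧
      (1 + lossless X)⁻¹ = (1 / 2 : ℂ) • (1 + U) ∧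
      ∀ c, U = Matrix.diagonal c → ∃ x, X = Matrix.diagonal x := by
  have hpd := (Matrix.isUnit_iff_isUnit_det _).1 hp
  set W : Matrix n n ℂ := -Complex.I • ((2 : ℂ) • (1 + U)⁻¹ - 1) with hW
  have hWT : Wᵀ = W := by
    rw [hW, Matrix.transpose_smul, Matrix.transpose_sub, Matrix.transpose_smul,
      Matrix.transpose_nonsing_inv, Matrix.transpose_add, Matrix.transpose_one, hsymm]
  have hinvH : ((1 + U)⁻¹)ᴴ = 1 - (1 + U)⁻¹ := by
    rw [Matrix.conjTranspose_nonsing_inv, Matrix.conjTranspose_add, Matrix.conjTranspose_one]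
    refine Matrix.inv_eq_left_inv ?_
    have h1 : (1 + U) * (1 + U)⁻¹ = 1 := Matrix.mul_nonsing_inv _ hpd
    have h2 : 1 + Uᴴ = (1 + U) * Uᴴ := by
      rw [add_mul, mul_eq_one_comm.1 hU, one_mul, add_comm]
    have h3 : 1 - (1 + U)⁻¹ = U * (1 + U)⁻¹ := by
      rw [sub_eq_iff_eq_add]
      nth_rewrite 1 [← h1]
      rw [add_mul, one_mul, add_comm]
    rw [h2, h3, Matrix.mul_assoc, Matrix.nonsing_inv_mul_cancel_left _ _ hpd,
      mul_eq_one_comm.1 hU]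
  have hWH : Wᴴ = W := by
    rw [hW, Matrix.conjTranspose_smul, Matrix.conjTranspose_sub, Matrix.conjTranspose_smul, hinvH,
      Matrix.conjTranspose_one]
    have : star (-Complex.I) = Complex.I := by simp
    have h2 : star (2 : ℂ) = 2 := by simp
    rw [this, h2, neg_smul, ← smul_neg]
    congr 1
    module
  have hreal : (W.map Complex.re).map Complex.ofReal = W := by
    ext i j
    have h : star (W i j) = W i j := by
      calc star (W i j) = Wᴴ j i := (Matrix.conjTranspose_apply _ _ _).symm
        _ = Wᵀ i j := by rw [hWH, Matrix.transpose_apply]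
        _ = W i j := by rw [hWT]
    exact Complex.conj_eq_iff_re.1 h
  have hIW : Complex.I • W = (2 : ℂ) • (1 + U)⁻¹ - 1 := by
    rw [hW, smul_smul, mul_neg, Complex.I_mul_I, neg_neg, one_smul]
  refine ⟨W.map Complex.re, ?_, ?_, ?_, ?_⟩
  · rw [Matrix.IsSymm, ← Matrix.transpose_map, hWT]
  · have hWu : IsUnit W := by
      have h1 : (2 : ℂ) • (1 + U)⁻¹ - 1 = (1 + U)⁻¹ * (1 - U) := by
        have h2 : (1 - U : Matrix n n ℂ) = (2 : ℂ) • 1 - (1 + U) := by module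
        rw [h2, mul_sub, Matrix.nonsing_inv_mul _ hpd, Matrix.mul_smul, Matrix.mul_one]
      have h3 : W = (-Complex.I • (1 : Matrix n n ℂ)) * ((1 + U)⁻¹ * (1 - U)) := by
        rw [hW, h1, Matrix.smul_mul, Matrix.one_mul]
      rw [h3]
      refine IsUnit.mul ?_ ((Matrix.isUnit_nonsing_inv_iff.2 hp).mul hm)
      rw [Matrix.isUnit_iff_isUnit_det, Matrix.det_smul, Matrix.det_one, mul_one]
      exact (isUnit_iff_ne_zero.2 (neg_ne_zero.2 Complex.I_ne_zero)).pow _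
    rw [Matrix.isUnit_iff_isUnit_det, isUnit_iff_ne_zero] at hWu ⊢
    intro h0
    apply hWu
    rw [← hreal]
    have := (RingHom.map_det Complex.ofRealHom (W.map Complex.re)).symm
    rw [h0, map_zero] at this
    exact this
  · refine Matrix.inv_eq_left_inv ?_
    rw [lossless, hreal, hIW, add_sub_cancel, Matrix.smul_mul, Matrix.mul_smul,
      Matrix.mul_nonsing_inv _ hpd, smul_smul]
    norm_num
  · rintro c rfl
    refine ⟨fun i => (W i i).re, ?_⟩
    have hdiag : ∀ i j, i ≠ j → W i j = 0 := by
      intro i j hij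
      rw [hW, ← Matrix.diagonal_one, Matrix.diagonal_add, Matrix.inv_diagonal]
      simp [hij]
    ext i j
    by_cases hij : i = j
    · subst hij
      simp
    · simp [hdiag i j hij, hij]

/-- Every scattering matrix `U` is approximated by phase shifts of itself without the eigenvalues
`± 1`, so its response is approached by invertible loads. -/
theorem exists_load_lt_norm_response (u v : n → ℂ) {U : Matrix n n ℂ} (hsymm : Uᵀ = U)
    (hU : Uᴴ * U = 1) {b : ℝ} (hb : b < 1 / 2 * ‖u ⬝ᵥ v + u ⬝ᵥ (U *ᵥ v)‖) :
    ∃ X : Matrix n n ℝ, X.IsSymm ∧ IsUnit X ∧ b < ‖response u v X‖ ∧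
      ∀ c, U = Matrix.diagonal c → ∃ x, X = Matrix.diagonal x := by
  -- pairwise distinct phases tending to `1`: only finitely many `± ζ m` are eigenvalues of `U`
  set ζ : ℕ → ℂ := fun m => Complex.exp (((1 / ((m : ℝ) + 1) : ℝ) : ℂ) * Complex.I) with hζ
  have hζ1 : ∀ m, ‖ζ m‖ = 1 := fun m => Complex.norm_exp_ofReal_mul_I _
  have hζ0 : ∀ m, ζ m ≠ 0 := fun m => Complex.exp_ne_zero _
  have hζlim : Tendsto ζ atTop (𝓝 1) := by
    have h1 : Continuous fun t : ℝ => Complex.exp ((t : ℂ) * Complex.I) := by fun_prop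
    have := (h1.tendsto 0).comp tendsto_one_div_add_atTop_nhds_zero_nat
    simp only [Complex.ofReal_zero, zero_mul, Complex.exp_zero] at this
    exact this
  have hinj : Function.Injective ζ := by
    intro a b hab
    have hb : ∀ m : ℕ, 0 < 1 / ((m : ℝ) + 1) ∧ 1 / ((m : ℝ) + 1) ≤ 1 := fun m =>
      ⟨by positivity, by rw [div_le_one (by positivity)]; linarith [m.cast_nonneg (α := ℝ)]⟩
    have him : ∀ r : ℝ, ((r : ℂ) * Complex.I).im = r := by intro r; simp
    have := Complex.exp_inj_of_neg_pi_lt_of_le_pi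
      (by rw [him]; linarith [(hb a).1, Real.pi_pos])
      (by rw [him]; linarith [(hb a).2, Real.pi_gt_three])
      (by rw [him]; linarith [(hb b).1, Real.pi_pos])
      (by rw [him]; linarith [(hb b).2, Real.pi_gt_three]) hab
    have := congrArg Complex.im this
    rw [him, him] at this
    have h3 : (a : ℝ) + 1 = b + 1 := by
      rw [one_div, one_div] at this
      exact inv_injective this
    exact_mod_cast add_right_cancel h3
  have hroots : ∀ s : ℂ, s ≠ 0 → ∀ᶠ m in atTop, ¬ U.charpoly.IsRoot (s * ζ m) := by
    intro s hs
    have hfin : {x | U.charpoly.IsRoot x}.Finite :=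
      Polynomial.finite_setOfPred_isRoot U.charpoly_monic.ne_zero
    have h := ((mul_right_injective₀ hs).comp hinj).tendsto_cofinite.eventually
      hfin.compl_mem_cofinite
    rw [Nat.cofinite_eq_atTop] at h
    exact h
  have hunit : ∀ (s : ℂ) (m : ℕ), s ≠ 0 → ¬ U.charpoly.IsRoot (s * ζ m) →
      IsUnit (1 - s⁻¹ • (ζ m)⁻¹ • U) := by
    intro s m hs h
    rw [Polynomial.IsRoot, Matrix.eval_charpoly] at h
    have e : 1 - s⁻¹ • (ζ m)⁻¹ • U =
        (s * ζ m)⁻¹ • (Matrix.scalar n (s * ζ m) - U) := by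
      rw [Matrix.scalar_apply, ← Matrix.smul_one_eq_diagonal, smul_sub, smul_smul,
        smul_smul _ _ (1 : Matrix n n ℂ), inv_mul_cancel₀ (mul_ne_zero hs (hζ0 m)), one_smul,
        mul_inv]
    rw [e, Matrix.isUnit_iff_isUnit_det, Matrix.det_smul, isUnit_iff_ne_zero]
    exact mul_ne_zero (pow_ne_zero _ (inv_ne_zero (mul_ne_zero hs (hζ0 m)))) h
  have hlim : Tendsto (fun m => 1 / 2 * ‖u ⬝ᵥ v + (ζ m)⁻¹ * u ⬝ᵥ (U *ᵥ v)‖) atTop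
      (𝓝 (1 / 2 * ‖u ⬝ᵥ v + u ⬝ᵥ (U *ᵥ v)‖)) := by
    have h := (((hζlim.inv₀ one_ne_zero).mul_const (u ⬝ᵥ (U *ᵥ v))).const_add
      (u ⬝ᵥ v)).norm.const_mul (1 / 2)
    simpa using h
  obtain ⟨m, hm1, hm2, hm3⟩ := ((hroots 1 one_ne_zero).and
    ((hroots (-1) (neg_ne_zero.2 one_ne_zero)).and (hlim.eventually_const_lt hb))).exists
  have hminus := hunit 1 m one_ne_zero hm1
  have hplus := hunit (-1) m (neg_ne_zero.2 one_ne_zero) hm2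
  rw [inv_one, one_smul] at hminus
  rw [inv_neg, inv_one, neg_smul, one_smul, sub_neg_eq_add] at hplus
  have hstar : star (ζ m)⁻¹ * (ζ m)⁻¹ = 1 := by
    rw [← starRingEnd_apply, ← Complex.normSq_eq_conj_mul_self, Complex.normSq_eq_norm_sq,
      norm_inv, hζ1]
    simp
  obtain ⟨X, hX1, hX2, hX3, hX4⟩ := exists_load_of_symmetric_unitary (U := (ζ m)⁻¹ • U)
    (by rw [Matrix.transpose_smul, hsymm])
    (by rw [Matrix.conjTranspose_smul, Matrix.smul_mul, Matrix.mul_smul, smul_smul, hstar, hU,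
      one_smul]) hplus hminus
  refine ⟨X, hX1, hX2, ?_, fun c hc => hX4 (fun i => (ζ m)⁻¹ * c i) ?_⟩
  · rw [response, hX3, Matrix.smul_mulVec, Matrix.add_mulVec, Matrix.one_mulVec,
      Matrix.smul_mulVec, dotProduct_smul, dotProduct_add, dotProduct_smul, smul_eq_mul,
      smul_eq_mul, norm_mul]
    have : ‖(1 / 2 : ℂ)‖ = 1 / 2 := by norm_num
    rw [this]
    exact hm3
  · rw [hc, ← Matrix.diagonal_smul]
    rfl

theorem exists_phase (z : ℂ) : ∃ c : ℂ, ‖c‖ = 1 ∧ z = c * (‖z‖ : ℂ) :=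
  ⟨Complex.exp (Complex.arg z * Complex.I), Complex.norm_exp_ofReal_mul_I _, by
    rw [mul_comm]; exact (Complex.norm_mul_exp_arg_mul_I z).symm⟩

theorem exists_diagonal_lt_norm_response (u v : n → ℂ) {b : ℝ} (hb : b < boundDiag u v) :
    ∃ x : n → ℝ, IsUnit (Matrix.diagonal x) ∧ b < ‖response u v (Matrix.diagonal x)‖ := by
  -- `U` turns every summand `uᵢ vᵢ` to the phase `c` of `uᵀ v`
  obtain ⟨c, hc, hcuv⟩ := exists_phase (u ⬝ᵥ v)
  choose e he heuv using fun i => exists_phase (u i * v i)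
  have hmul : ∀ z : ℂ, ‖z‖ = 1 → star z * z = 1 := by
    intro z hz
    rw [← starRingEnd_apply, ← Complex.normSq_eq_conj_mul_self, Complex.normSq_eq_norm_sq, hz]
    simp
  set U : Matrix n n ℂ := Matrix.diagonal fun i => c * star (e i) with hU
  have hdot : u ⬝ᵥ (U *ᵥ v) = c * ((∑ i, ‖u i * v i‖ : ℝ) : ℂ) := by
    rw [dotProduct, Complex.ofReal_sum, Finset.mul_sum]
    refine Finset.sum_congr rfl fun i _ => ?_
    rw [hU, Matrix.mulVec_diagonal]
    calc u i * (c * star (e i) * v i) = c * star (e i) * (u i * v i) := by ring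
      _ = c * (star (e i) * e i) * ‖u i * v i‖ := by
        nth_rewrite 1 [heuv i]
        ring
      _ = c * ‖u i * v i‖ := by rw [hmul _ (he i), mul_one]
  obtain ⟨X, -, hX2, hX3, hX4⟩ := exists_load_lt_norm_response u v (U := U) (b := b)
    (Matrix.diagonal_transpose _)
    (by
      rw [hU, Matrix.diagonal_conjTranspose, Matrix.diagonal_mul_diagonal, ← Matrix.diagonal_one]
      congr 1
      funext i
      refine hmul _ ?_
      rw [norm_mul, norm_star, hc, he, mul_one])
    (by
      rw [hdot]
      nth_rewrite 1 [hcuv]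
      rw [← mul_add, norm_mul, hc, one_mul, ← Complex.ofReal_add, Complex.norm_real,
        Real.norm_of_nonneg (by positivity)]
      exact hb)
  obtain ⟨x, rfl⟩ := hX4 _ hU
  exact ⟨x, hX2, hX3⟩

end Response

/-- Two vectors `p`, `y` of the same norm are complex conjugates of each other in some orthonormal
basis: the vectors `p + y` and `j (p - y)` have a real inner product, so there is an orthonormal
basis in which both have real coordinates. -/
theorem exists_orthonormalBasis_inner_eq_star {N : ℕ} {p y : EuclideanSpace ℂ (Fin N)}
    (h : ‖p‖ = ‖y‖) : ∃ b : OrthonormalBasis (Fin N) ℂ (EuclideanSpace ℂ (Fin N)),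
      ∀ k, inner ℂ (b k) y = star (inner ℂ (b k) p) := by
  set f₁ := p + y with hf₁
  set f₂ := Complex.I • (p - y) with hf₂
  set e₁ := ((‖f₁‖⁻¹ : ℝ) : ℂ) • f₁ with he₁
  have hf₁e : f₁ = (‖f₁‖ : ℂ) • e₁ := by
    rcases eq_or_ne f₁ 0 with h0 | h0
    · simp [he₁, h0]
    · have : (‖f₁‖ : ℂ) ≠ 0 := by exact_mod_cast norm_ne_zero_iff.2 h0
      rw [he₁, smul_smul, Complex.ofReal_inv, mul_inv_cancel₀ this, one_smul]
  have hreal : (inner ℂ f₁ f₂).im = 0 := by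
    rw [hf₁, hf₂, inner_smul_right, inner_add_left, inner_sub_right, inner_sub_right,
      inner_self_eq_norm_sq_to_K, inner_self_eq_norm_sq_to_K, h]
    have hs : (inner ℂ y p).re = (inner ℂ p y).re := by rw [← inner_conj_symm, Complex.conj_re]
    simp [hs]
  set c := (inner ℂ e₁ f₂).re with hc
  have hce : inner ℂ e₁ f₂ = (c : ℂ) := by
    refine Complex.ext rfl ?_
    rw [he₁, inner_smul_left, Complex.conj_ofReal, Complex.im_ofReal_mul, hreal]
    simp
  set g := f₂ - (c : ℂ) • e₁ with hg
  set e₂ := ((‖g‖⁻¹ : ℝ) : ℂ) • g with he₂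
  have hge : g = (‖g‖ : ℂ) • e₂ := by
    rcases eq_or_ne g 0 with h0 | h0
    · simp [he₂, h0]
    · have : (‖g‖ : ℂ) ≠ 0 := by exact_mod_cast norm_ne_zero_iff.2 h0
      rw [he₂, smul_smul, Complex.ofReal_inv, mul_inv_cancel₀ this, one_smul]
  have hunit : ∀ f : EuclideanSpace ℂ (Fin N), ((‖f‖⁻¹ : ℝ) : ℂ) • f ≠ 0 →
      inner ℂ (((‖f‖⁻¹ : ℝ) : ℂ) • f) (((‖f‖⁻¹ : ℝ) : ℂ) • f) = (1 : ℂ) := by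
    intro f hf
    have hf0 : ‖f‖ ≠ 0 := by
      intro h0
      simp [norm_eq_zero.1 h0] at hf
    rw [inner_self_eq_norm_sq_to_K, norm_smul, Complex.norm_real, norm_inv, norm_norm,
      inv_mul_cancel₀ hf0]
    simp
  have horth : inner ℂ e₁ e₂ = (0 : ℂ) := by
    rcases eq_or_ne e₁ 0 with h0 | h0
    · rw [h0, inner_zero_left]
    · rw [he₂, inner_smul_right, hg, inner_sub_right, inner_smul_right e₁ e₁ (c : ℂ), hunit f₁ h0,
        hce]
      ring
  have horth' : inner ℂ e₂ e₁ = (0 : ℂ) := by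
    rw [← inner_conj_symm, horth, map_zero]
  set s : Set (EuclideanSpace ℂ (Fin N)) := {e₁, e₂} \ {0} with hs
  have hon : Orthonormal ℂ (Subtype.val : s → EuclideanSpace ℂ (Fin N)) := by
    classical
    rw [orthonormal_subtype_iff_ite]
    rintro v ⟨hv, hv0⟩ w ⟨hw, hw0⟩
    have hv0 : v ≠ 0 := hv0
    have hw0 : w ≠ 0 := hw0
    have key : ∀ {v w : EuclideanSpace ℂ (Fin N)}, v ≠ 0 → inner ℂ v w = (0 : ℂ) → v ≠ w := by
      rintro v w hv h rfl
      exact hv (inner_self_eq_zero.1 h)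
    rcases hv with rfl | rfl <;> rcases hw with rfl | rfl
    · rw [if_pos rfl, hunit f₁ hv0]
    · rw [if_neg (key hv0 horth), horth]
    · rw [if_neg (key hv0 horth'), horth']
    · rw [if_pos rfl, hunit g hv0]
  obtain ⟨w, b', hsw, hb'⟩ := hon.exists_orthonormalBasis_extension
  have hcard : Fintype.card w = N := by
    rw [← Module.finrank_eq_card_basis b'.toBasis, finrank_euclideanSpace_fin]
  set b := b'.reindex (Fintype.equivFinOfCardEq hcard) with hb
  have him : ∀ e ∈ ({e₁, e₂} : Set (EuclideanSpace ℂ (Fin N))), ∀ k, (inner ℂ (b k) e).im = 0 := by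
    intro e he k
    rcases eq_or_ne e 0 with h0 | h0
    · simp [h0]
    · have hew : e ∈ (w : Set _) := hsw ⟨he, h0⟩
      have hbe : b (Fintype.equivFinOfCardEq hcard ⟨e, hew⟩) = e := by
        rw [hb, OrthonormalBasis.reindex_apply, Equiv.symm_apply_apply, hb']
      rw [← hbe, b.inner_eq_ite]
      split_ifs <;> simp
  refine ⟨b, fun k => ?_⟩
  have h1 : (inner ℂ (b k) f₁).im = 0 := by
    rw [hf₁e, inner_smul_right, Complex.im_ofReal_mul, him e₁ (Or.inl rfl) k, mul_zero]
  have h2 : (inner ℂ (b k) f₂).im = 0 := by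
    have : f₂ = (c : ℂ) • e₁ + (‖g‖ : ℂ) • e₂ := by rw [← hge, hg, add_sub_cancel]
    rw [this, inner_add_right, inner_smul_right (b k) e₁ (c : ℂ),
      inner_smul_right (b k) e₂ (‖g‖ : ℂ), Complex.add_im, Complex.im_ofReal_mul, Complex.im_ofReal_mul, him e₁ (Or.inl rfl) k,
      him e₂ (Or.inr rfl) k]
    ring
  rw [hf₁, inner_add_right, Complex.add_im] at h1
  rw [hf₂, inner_smul_right, inner_sub_right, Complex.I_mul_im, Complex.sub_re] at h2
  refine Complex.ext ?_ ?_
  · rw [← starRingEnd_apply, Complex.conj_re]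
    linarith
  · rw [← starRingEnd_apply, Complex.conj_im]
    linarith

/-- Takagi-type transitivity: symmetric unitary matrices act transitively on spheres. -/
theorem exists_symmetric_unitary_mulVec_eq {N : ℕ} {v y : Fin N → ℂ} (h : l2norm v = l2norm y) :
    ∃ U : Matrix (Fin N) (Fin N) ℂ, Uᵀ = U ∧ Uᴴ * U = 1 ∧ U *ᵥ v = y := by
  obtain ⟨b, hb⟩ := exists_orthonormalBasis_inner_eq_star (p := WithLp.toLp 2 (star v))
    (y := WithLp.toLp 2 y) (by
      have := l2norm_star v
      rw [l2norm] at this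
      rw [this, h, l2norm])
  set Q : Matrix (Fin N) (Fin N) ℂ := Matrix.of fun i k => b k i with hQ
  have hQQ : Qᴴ * Q = 1 := by
    ext k l
    have := b.inner_eq_ite k l
    rw [EuclideanSpace.inner_eq_star_dotProduct] at this
    rw [Matrix.one_apply, ← this, Matrix.mul_apply, dotProduct]
    refine Finset.sum_congr rfl fun i _ => ?_
    rw [Matrix.conjTranspose_apply, mul_comm]
    rfl
  refine ⟨Q * Qᵀ, ?_, ?_, ?_⟩
  · rw [Matrix.transpose_mul, Matrix.transpose_transpose]
  · have h1 : (Qᵀ)ᴴ * Qᵀ = 1 := by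
      have h2 : (Qᵀ)ᴴ = (Qᴴ)ᵀ := rfl
      rw [h2, ← Matrix.transpose_mul, mul_eq_one_comm.1 hQQ, Matrix.transpose_one]
    rw [Matrix.conjTranspose_mul, Matrix.mul_assoc, ← Matrix.mul_assoc Qᴴ, hQQ, Matrix.one_mul, h1]
  · have hc : Qᵀ *ᵥ v = Qᴴ *ᵥ y := by
      funext k
      have := hb k
      rw [EuclideanSpace.inner_eq_star_dotProduct, EuclideanSpace.inner_eq_star_dotProduct,
        dotProduct, dotProduct, star_sum] at this
      rw [Matrix.mulVec, Matrix.mulVec, dotProduct, dotProduct]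
      calc ∑ i, Qᵀ k i * v i = ∑ i, star (star v i * star (b k i)) := by
            refine Finset.sum_congr rfl fun i _ => ?_
            rw [star_mul', Pi.star_apply, star_star, star_star, mul_comm]
            rfl
        _ = ∑ i, y i * star (b k i) := this.symm
        _ = _ := by
            refine Finset.sum_congr rfl fun i _ => ?_
            rw [Matrix.conjTranspose_apply, mul_comm]
            rfl
    rw [← Matrix.mulVec_mulVec, hc, Matrix.mulVec_mulVec, mul_eq_one_comm.1 hQQ,
      Matrix.one_mulVec]

theorem exists_symmetric_lt_norm_response {N : ℕ} (u v : Fin N → ℂ) {b : ℝ}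
    (hb : b < boundFull u v) :
    ∃ X : Matrix (Fin N) (Fin N) ℝ, X.IsSymm ∧ IsUnit X ∧ b < ‖response u v X‖ := by
  obtain ⟨c, hc, hcuv⟩ := exists_phase (u ⬝ᵥ v)
  obtain ⟨U, hU1, hU2, hU3⟩ : ∃ U : Matrix (Fin N) (Fin N) ℂ, Uᵀ = U ∧ Uᴴ * U = 1 ∧
      u ⬝ᵥ (U *ᵥ v) = c * ((l2norm u * l2norm v : ℝ) : ℂ) := by
    rcases eq_or_ne (l2norm u) 0 with h0 | h0
    · refine ⟨1, Matrix.transpose_one, by simp, ?_⟩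
      have := norm_dotProduct_le u v
      rw [h0, zero_mul] at this
      rw [h0, zero_mul, Matrix.one_mulVec, norm_le_zero_iff.1 this]
      simp
    · -- the matched vector, a multiple of `star u` with the phase of `u ⬝ᵥ v`
      set y : Fin N → ℂ := (c * ((l2norm v / l2norm u : ℝ) : ℂ)) • star u with hy
      have hyn : l2norm v = l2norm y := by
        rw [hy, l2norm, l2norm, WithLp.toLp_smul, norm_smul, norm_mul, hc, one_mul,
          Complex.norm_real, Real.norm_of_nonneg (div_nonneg (norm_nonneg _) (l2norm_nonneg u))]
        have := l2norm_star u
        rw [l2norm] at this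
        rw [this, div_mul_cancel₀ _ h0]
      obtain ⟨U, h1, h2, h3⟩ := exists_symmetric_unitary_mulVec_eq hyn
      refine ⟨U, h1, h2, ?_⟩
      have h0' : (l2norm u : ℂ) ≠ 0 := by exact_mod_cast h0
      rw [h3, hy, dotProduct_smul, dotProduct_comm, star_dotProduct_self, smul_eq_mul]
      push_cast
      field_simp
  obtain ⟨X, h1, h2, h3, -⟩ := exists_load_lt_norm_response u v hU1 hU2 (b := b) (by
    rw [hU3]
    nth_rewrite 1 [hcuv]
    have := mul_nonneg (l2norm_nonneg u) (l2norm_nonneg v)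
    rw [← mul_add, norm_mul, hc, one_mul, ← Complex.ofReal_add, Complex.norm_real,
      Real.norm_of_nonneg (by positivity)]
    exact hb)
  exact ⟨X, h1, h2, h3⟩

/-! ### Channel gains and array gains -/

/-- The channel magnitude of a single radiator with optimal load. -/
noncomputable def singleGain (R γDR γRS : ℝ) : ℝ := Real.sqrt γDR * Real.sqrt γRS * R

/-- After factoring out the square roots of `Re Z_R` on both sides, the channel is the response of
the normalized load `W` to the whitened array vectors. -/
theorem norm_losChannel_eq {N : ℕ} {lam R d : ℝ} (hR : 0 < R) (γDR γRS αRx αTx : ℝ) {ZN : Matrix (Fin N) (Fin N) ℂ} {W : Matrix (Fin N) (Fin N) ℝ}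
    (hZ : impedanceMatrix N lam R d + ZN =
      sqrtResistanceC N lam R d * (1 + lossless W) * sqrtResistanceC N lam R d) :
    ‖losChannel N lam R γDR γRS αRx αTx d ZN‖ = singleGain R γDR γRS *
      ‖response (whitened N lam R d αRx) (whitened N lam R d αTx) W‖ := by
  set S := sqrtResistanceC N lam R d with hS
  have hs : (Real.sqrt R : ℂ) * Real.sqrt R = R := by
    exact_mod_cast Real.mul_self_sqrt hR.le
  have hST : (S⁻¹)ᵀ = S⁻¹ := by
    rw [Matrix.transpose_nonsing_inv, sqrtResistanceC_transpose]
  have hresp : response (whitened N lam R d αRx) (whitened N lam R d αTx) W =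
      R * (steering N lam d αRx ⬝ᵥ
        ((S⁻¹ * (1 + lossless W)⁻¹ * S⁻¹) *ᵥ steering N lam d αTx)) := by
    rw [response, whitened, whitened, ← hS, Matrix.mulVec_smul, smul_dotProduct, dotProduct_smul,
      smul_smul, hs, smul_eq_mul]
    congr 1
    nth_rewrite 1 [← hST]
    rw [Matrix.mulVec_transpose, ← Matrix.dotProduct_mulVec, Matrix.mulVec_mulVec,
      Matrix.mulVec_mulVec, Matrix.mul_assoc]
  have hch : losChannel N lam R γDR γRS αRx αTx d ZN =
      -((singleGain R γDR γRS : ℝ) : ℂ) *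
        response (whitened N lam R d αRx) (whitened N lam R d αTx) W := by
    rw [losChannel, channel, hZ, Matrix.mul_inv_rev, Matrix.mul_inv_rev, zero_sub,
      Matrix.mulVec_smul, smul_dotProduct, dotProduct_smul, smul_eq_mul, smul_eq_mul, hresp,
      singleGain, Matrix.mul_assoc S⁻¹]
    push_cast
    ring
  rw [hch, norm_mul, norm_neg, Complex.norm_real, Real.norm_of_nonneg]
  unfold singleGain
  positivity

theorem lossless_add {ι : Type*} (X Y : Matrix ι ι ℝ) :
    lossless (X + Y) = lossless X + lossless Y := by
  ext i j
  simp [lossless, mul_add]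

theorem sqrtResistanceC_mul_lossless_mul (N : ℕ) (lam R d : ℝ) (W : Matrix (Fin N) (Fin N) ℝ) :
    sqrtResistanceC N lam R d * lossless W * sqrtResistanceC N lam R d =
      lossless (sqrtResistance N lam R d * W * sqrtResistance N lam R d) := by
  rw [lossless, lossless, map_ofReal_mul, map_ofReal_mul, Matrix.mul_smul, Matrix.smul_mul]

theorem impedanceMatrix_add_lossless {N : ℕ} {lam R d : ℝ} (hlam : 0 < lam) (hR : 0 < R)
    (hd : 0 < d) {X W : Matrix (Fin N) (Fin N) ℝ}
    (hXW : reactance N lam R d + X = sqrtResistance N lam R d * W * sqrtResistance N lam R d) :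
    impedanceMatrix N lam R d + lossless X =
      sqrtResistanceC N lam R d * (1 + lossless W) * sqrtResistanceC N lam R d := by
  rw [impedanceMatrix_eq, add_assoc, ← lossless_add, hXW, Matrix.mul_add, Matrix.mul_one,
    Matrix.add_mul, sqrtResistanceC_mul_self hlam hR hd, sqrtResistanceC_mul_lossless_mul]

/-- The power matching network cancels `Im Z_R` and turns the load `X` into the normalized load
`-R X⁻¹`. -/
theorem impedanceMatrix_add_throughNetwork {N : ℕ} {lam R d : ℝ} (hlam : 0 < lam) (hR : 0 < R)
    (hd : 0 < d) {X : Matrix (Fin N) (Fin N) ℝ} (hX : IsUnit X) :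
    impedanceMatrix N lam R d + throughNetwork (powerMatching N lam R d) (lossless X) =
      sqrtResistanceC N lam R d * (1 + lossless (-R • X⁻¹)) * sqrtResistanceC N lam R d := by
  have hs : (Real.sqrt R : ℂ) * Real.sqrt R = R := by
    exact_mod_cast Real.mul_self_sqrt hR.le
  have h11 : (powerMatching N lam R d).toBlocks₁₁ = 0 := by
    ext i j
    simp [powerMatching, lossless, Matrix.toBlocks₁₁]
  have h12 : (powerMatching N lam R d).toBlocks₁₂ =
      (-Complex.I * Real.sqrt R) • sqrtResistanceC N lam R d := by
    ext i j
    simp [powerMatching, lossless, Matrix.toBlocks₁₂, sqrtResistanceC, sqrtResistance]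
    ring
  have h22 : (powerMatching N lam R d).toBlocks₂₂ = -lossless (reactance N lam R d) := by
    ext i j
    simp [powerMatching, lossless, Matrix.toBlocks₂₂]
  have hXC : IsUnit (X.map Complex.ofReal).det :=
    (Matrix.isUnit_iff_isUnit_det _).1 (isUnit_map_ofReal hX)
  have hinv : (lossless X)⁻¹ = -Complex.I • (X.map Complex.ofReal)⁻¹ := by
    refine Matrix.inv_eq_left_inv ?_
    rw [lossless, Matrix.smul_mul, Matrix.mul_smul, smul_smul, Matrix.nonsing_inv_mul _ hXC,
      neg_mul, Complex.I_mul_I, neg_neg, one_smul]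
  have hW : lossless (-R • X⁻¹) = (-Complex.I * R) • (X.map Complex.ofReal)⁻¹ := by
    rw [← map_ofReal_inv hX]
    ext i j
    simp [lossless]
    ring
  rw [throughNetwork, h11, h12, h22, zero_add, hinv, hW, impedanceMatrix_eq,
    Matrix.transpose_smul, sqrtResistanceC_transpose, Matrix.mul_add, Matrix.mul_one,
    Matrix.add_mul, sqrtResistanceC_mul_self hlam hR hd]
  simp only [Matrix.smul_mul, Matrix.mul_smul, smul_smul]
  have hc : -Complex.I * Real.sqrt R * (-Complex.I * (-Complex.I * Real.sqrt R)) =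
      -(-Complex.I * R) := by
    linear_combination -(Complex.I * Real.sqrt R * Real.sqrt R) * Complex.I_mul_I +
      Complex.I * hs
  rw [hc, neg_smul]
  abel

theorem iSup_ofReal_sq_eq {ι : Type*} {T : Set ι} {f : ι → ℝ} {B : ℝ} (hf : ∀ x, 0 ≤ f x)
    (hle : ∀ x ∈ T, f x ≤ B) (hlt : ∀ b < B, ∃ x ∈ T, b < f x) (hB : 0 ≤ B) :
    ⨆ x ∈ T, ENNReal.ofReal (f x ^ 2) = ENNReal.ofReal (B ^ 2) := by
  refine le_antisymm (iSup₂_le fun x hx => ?_) ?_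
  · have := hf x
    have := hle x hx
    gcongr
  · rcases hB.eq_or_lt with rfl | hB
    · simp
    have hlim : Tendsto (fun b : ℝ => ENNReal.ofReal (b ^ 2)) (𝓝[<] B)
        (𝓝 (ENNReal.ofReal (B ^ 2))) :=
      ((ENNReal.continuous_ofReal.comp (continuous_pow 2)).tendsto B).mono_left nhdsWithin_le_nhds
    refine le_of_tendsto hlim ?_
    filter_upwards [self_mem_nhdsWithin, nhdsWithin_le_nhds (Ioi_mem_nhds hB)] with b hb hb0
    obtain ⟨x, hx, hbx⟩ := hlt b hb
    have hb0 : 0 < b := hb0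
    refine le_trans ?_ (le_iSup₂ (f := fun x _ => ENNReal.ofReal (f x ^ 2)) x hx)
    gcongr

theorem singleGain_pos {R γDR γRS : ℝ} (hR : 0 < R) (hγDR : 0 < γDR) (hγRS : 0 < γRS) :
    0 < singleGain R γDR γRS := by
  unfold singleGain
  positivity

section Gains

variable {N : ℕ} {lam R γDR γRS d : ℝ}

/-- Without decoupling network the normalized load `W` ranges over all real symmetric matrices,
through `X = (Re Z_R)^(1/2) W (Re Z_R)^(1/2) - Im Z_R`. -/
theorem channelGain_fullyConnected (hlam : 0 < lam) (hR : 0 < R) (hγDR : 0 < γDR)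
    (hγRS : 0 < γRS) (hd : 0 < d) (αRx αTx : ℝ) :
    channelGain N (fullyConnected N) lam R γDR γRS αRx αTx d =
      ENNReal.ofReal ((singleGain R γDR γRS *
        boundFull (whitened N lam R d αRx) (whitened N lam R d αTx)) ^ 2) := by
  have hc := singleGain_pos hR hγDR hγRS
  have hS := (Matrix.isUnit_iff_isUnit_det _).1 (isUnit_sqrtResistance (N := N) hlam hR hd)
  have hST := (sqrtResistance_isSymm N lam R d).eq
  have hSiT : ((sqrtResistance N lam R d)⁻¹)ᵀ = (sqrtResistance N lam R d)⁻¹ := by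
    rw [Matrix.transpose_nonsing_inv, hST]
  refine iSup_ofReal_sq_eq (fun _ => norm_nonneg _) ?_ ?_
    (mul_nonneg hc.le (boundFull_nonneg _ _))
  · intro X hX
    have hX : Xᵀ = X := hX
    set W := (sqrtResistance N lam R d)⁻¹ * (reactance N lam R d + X) *
      (sqrtResistance N lam R d)⁻¹ with hW
    have hWs : W.IsSymm := by
      rw [Matrix.IsSymm, hW, Matrix.transpose_mul, Matrix.transpose_mul, Matrix.transpose_add, hX,
        (reactance_isSymm N lam R d).eq, hSiT, Matrix.mul_assoc]
    have hXW : reactance N lam R d + X =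
        sqrtResistance N lam R d * W * sqrtResistance N lam R d := by
      rw [hW, Matrix.mul_assoc, Matrix.mul_assoc, Matrix.nonsing_inv_mul _ hS, Matrix.mul_one,
        Matrix.mul_nonsing_inv_cancel_left _ _ hS]
    rw [norm_losChannel_eq hR _ _ _ _ (impedanceMatrix_add_lossless hlam hR hd hXW)]
    exact mul_le_mul_of_nonneg_left (norm_response_le_boundFull _ _ hWs) hc.le
  · intro b hb
    rw [mul_comm, ← div_lt_iff₀ hc] at hb
    obtain ⟨W, hWs, -, hWb⟩ := exists_symmetric_lt_norm_response _ _ hb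
    refine ⟨sqrtResistance N lam R d * W * sqrtResistance N lam R d - reactance N lam R d, ?_, ?_⟩
    · change _ᵀ = _
      rw [Matrix.transpose_sub, Matrix.transpose_mul, Matrix.transpose_mul, hST, hWs.eq,
        (reactance_isSymm N lam R d).eq, Matrix.mul_assoc]
    · rw [norm_losChannel_eq hR _ _ _ _
        (impedanceMatrix_add_lossless hlam hR hd (add_sub_cancel _ _)), mul_comm]
      exact (div_lt_iff₀ hc).1 hWb

/-- With the power matching network the normalized loads are `W = -R X⁻¹` with `X` invertible, for
any architecture closed under this involution. -/
theorem channelGainDN_eq {T : Set (Matrix (Fin N) (Fin N) ℝ)} {B : ℝ} {αRx αTx : ℝ}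
    (hlam : 0 < lam) (hR : 0 < R) (hγDR : 0 < γDR) (hγRS : 0 < γRS) (hd : 0 < d)
    (hT : ∀ X ∈ T, IsUnit X → -R • X⁻¹ ∈ T) (hB : 0 ≤ B)
    (hle : ∀ W ∈ T, ‖response (whitened N lam R d αRx) (whitened N lam R d αTx) W‖ ≤ B)
    (hlt : ∀ b < B, ∃ W ∈ T, IsUnit W ∧
      b < ‖response (whitened N lam R d αRx) (whitened N lam R d αTx) W‖) :
    channelGainDN N T lam R γDR γRS αRx αTx d =
      ENNReal.ofReal ((singleGain R γDR γRS * B) ^ 2) := by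
  have hc := singleGain_pos hR hγDR hγRS
  have hR' : -R ≠ 0 := neg_ne_zero.2 hR.ne'
  refine iSup_ofReal_sq_eq (fun _ => norm_nonneg _) ?_ ?_ (mul_nonneg hc.le hB)
  · rintro X ⟨hXT, hX⟩
    rw [norm_losChannel_eq hR _ _ _ _ (impedanceMatrix_add_throughNetwork hlam hR hd hX)]
    exact mul_le_mul_of_nonneg_left (hle _ (hT X hXT hX)) hc.le
  · intro b hb
    rw [mul_comm, ← div_lt_iff₀ hc] at hb
    obtain ⟨W, hWT, hW, hWb⟩ := hlt _ hb
    have hWd := (Matrix.isUnit_iff_isUnit_det _).1 hW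
    have hX : IsUnit (-R • W⁻¹) := by
      rw [Matrix.isUnit_iff_isUnit_det, Matrix.det_smul]
      exact ((isUnit_iff_ne_zero.2 hR').pow _).mul
        ((Matrix.isUnit_iff_isUnit_det _).1 (Matrix.isUnit_nonsing_inv_iff.2 hW))
    have hinv : -R • (-R • W⁻¹)⁻¹ = W := by
      have : (-R • W⁻¹)⁻¹ = (-R)⁻¹ • W := by
        refine Matrix.inv_eq_left_inv ?_
        rw [Matrix.smul_mul, Matrix.mul_smul, smul_smul, inv_mul_cancel₀ hR', one_smul,
          Matrix.mul_nonsing_inv _ hWd]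
      rw [this, smul_smul, mul_inv_cancel₀ hR', one_smul]
    refine ⟨-R • W⁻¹, ⟨hT W hWT hW, hX⟩, ?_⟩
    rw [norm_losChannel_eq hR _ _ _ _ (impedanceMatrix_add_throughNetwork hlam hR hd hX),
      hinv, mul_comm]
    exact (div_lt_iff₀ hc).1 hWb

theorem channelGainDN_fullyConnected (hlam : 0 < lam) (hR : 0 < R) (hγDR : 0 < γDR)
    (hγRS : 0 < γRS) (hd : 0 < d) (αRx αTx : ℝ) :
    channelGainDN N (fullyConnected N) lam R γDR γRS αRx αTx d =
      ENNReal.ofReal ((singleGain R γDR γRS *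
        boundFull (whitened N lam R d αRx) (whitened N lam R d αTx)) ^ 2) := by
  refine channelGainDN_eq hlam hR hγDR hγRS hd ?_ (boundFull_nonneg _ _)
    (fun W hW => norm_response_le_boundFull _ _ hW) (fun b hb => ?_)
  · intro X hX _
    change _ᵀ = _
    rw [Matrix.transpose_smul, Matrix.transpose_nonsing_inv, show Xᵀ = X from hX]
  · exact exists_symmetric_lt_norm_response _ _ hb

theorem channelGainDN_singleConnected (hlam : 0 < lam) (hR : 0 < R) (hγDR : 0 < γDR)
    (hγRS : 0 < γRS) (hd : 0 < d) (αRx αTx : ℝ) :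
    channelGainDN N (singleConnected N) lam R γDR γRS αRx αTx d =
      ENNReal.ofReal ((singleGain R γDR γRS *
        boundDiag (whitened N lam R d αRx) (whitened N lam R d αTx)) ^ 2) := by
  refine channelGainDN_eq hlam hR hγDR hγRS hd ?_ (boundDiag_nonneg _ _) ?_ (fun b hb => ?_)
  · rintro _ ⟨x, rfl⟩ _
    refine ⟨fun i => -R * Ring.inverse x i, ?_⟩
    change Matrix.diagonal _ = -R • (Matrix.diagonal x)⁻¹
    rw [Matrix.inv_diagonal, ← Matrix.diagonal_smul]
    rfl
  · rintro _ ⟨x, rfl⟩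
    exact norm_response_le_boundDiag _ _ x
  · obtain ⟨x, h1, h2⟩ := exists_diagonal_lt_norm_response _ _ hb
    exact ⟨_, ⟨x, rfl⟩, h1, h2⟩

theorem singleConnected_subset (N : ℕ) : singleConnected N ⊆ fullyConnected N := by
  rintro _ ⟨x, rfl⟩
  exact Matrix.diagonal_transpose x

theorem singleConnected_one : singleConnected 1 = fullyConnected 1 := by
  refine (singleConnected_subset 1).antisymm fun X _ => ⟨fun i => X i i, ?_⟩
  ext i j
  rw [Subsingleton.elim j i]
  exact Matrix.diagonal_apply_eq _ i

theorem star_whitened_one_dotProduct (hlam : 0 < lam) (hR : 0 < R) (hd : 0 < d) (α β : ℝ) :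
    star (whitened 1 lam R d α) ⬝ᵥ whitened 1 lam R d β = 1 := by
  have hC : couplingMatrix 1 lam R d = 1 := by
    ext i j
    rw [Subsingleton.elim j i, Matrix.one_apply_eq, couplingMatrix, Matrix.smul_apply,
      resistance_apply_self, smul_eq_mul, inv_mul_cancel₀ hR.ne']
  rw [whitened_dotProduct hlam hR hd, hC, inv_one]
  simp [dotProduct, Matrix.mulVec, steering]

theorem boundFull_whitened_one (hlam : 0 < lam) (hR : 0 < R) (hd : 0 < d) (α β : ℝ) :
    boundFull (whitened 1 lam R d α) (whitened 1 lam R d β) = 1 ∧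
      boundDiag (whitened 1 lam R d α) (whitened 1 lam R d β) = 1 := by
  have hnorm : ∀ γ, l2norm (whitened 1 lam R d γ) = 1 := by
    intro γ
    have h := star_whitened_one_dotProduct hlam hR hd γ γ
    rw [star_dotProduct_self] at h
    have h' : l2norm (whitened 1 lam R d γ) ^ 2 = 1 := by exact_mod_cast h
    have := l2norm_nonneg (whitened 1 lam R d γ)
    nlinarith
  have hdot : whitened 1 lam R d α ⬝ᵥ whitened 1 lam R d β = 1 := by
    have h := star_whitened_one_dotProduct hlam hR hd (Real.pi - α) β
    rwa [whitened_pi_sub, star_star] at h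
  have hsum : ∑ i, ‖whitened 1 lam R d α i * whitened 1 lam R d β i‖ = 1 := by
    have := congrArg norm hdot
    rw [dotProduct, Fin.sum_univ_one, norm_one] at this
    rw [Fin.sum_univ_one, this]
  constructor
  · rw [boundFull, hnorm, hnorm, hdot]
    norm_num
  · rw [boundDiag, hsum, hdot]
    norm_num

theorem ofReal_mul_sq_div {c B : ℝ} (hc : 0 < c) :
    ENNReal.ofReal ((c * B) ^ 2) / ENNReal.ofReal ((c * 1) ^ 2) = ENNReal.ofReal (B ^ 2) := by
  rw [← ENNReal.ofReal_div_of_pos (by positivity)]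
  congr 1
  field_simp

theorem gainBD_eq (hlam : 0 < lam) (hR : 0 < R) (hγDR : 0 < γDR) (hγRS : 0 < γRS) (hd : 0 < d)
    (αRx αTx : ℝ) : gainBD N lam R γDR γRS αRx αTx d = ENNReal.ofReal
      (boundFull (whitened N lam R d αRx) (whitened N lam R d αTx) ^ 2) := by
  rw [gainBD, channelGain_fullyConnected hlam hR hγDR hγRS hd,
    channelGain_fullyConnected hlam hR hγDR hγRS hd, (boundFull_whitened_one hlam hR hd _ _).1,
    ofReal_mul_sq_div (singleGain_pos hR hγDR hγRS)]

theorem gainBDDN_eq (hlam : 0 < lam) (hR : 0 < R) (hγDR : 0 < γDR) (hγRS : 0 < γRS) (hd : 0 < d)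
    (αRx αTx : ℝ) : gainBDDN N lam R γDR γRS αRx αTx d = ENNReal.ofReal
      (boundFull (whitened N lam R d αRx) (whitened N lam R d αTx) ^ 2) := by
  rw [gainBDDN, channelGainDN_fullyConnected hlam hR hγDR hγRS hd,
    channelGainDN_fullyConnected hlam hR hγDR hγRS hd, (boundFull_whitened_one hlam hR hd _ _).1,
    ofReal_mul_sq_div (singleGain_pos hR hγDR hγRS)]

theorem gainDDN_eq (hlam : 0 < lam) (hR : 0 < R) (hγDR : 0 < γDR) (hγRS : 0 < γRS) (hd : 0 < d)
    (αRx αTx : ℝ) : gainDDN N lam R γDR γRS αRx αTx d = ENNReal.ofReal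
      (boundDiag (whitened N lam R d αRx) (whitened N lam R d αTx) ^ 2) := by
  rw [gainDDN, channelGainDN_singleConnected hlam hR hγDR hγRS hd,
    channelGainDN_singleConnected hlam hR hγDR hγRS hd, (boundFull_whitened_one hlam hR hd _ _).2,
    ofReal_mul_sq_div (singleGain_pos hR hγDR hγRS)]

theorem gainD_le_gainBD (N : ℕ) (lam R γDR γRS αRx αTx d : ℝ) :
    gainD N lam R γDR γRS αRx αTx d ≤ gainBD N lam R γDR γRS αRx αTx d := by
  rw [gainD, gainBD, singleConnected_one]
  exact ENNReal.div_le_div_right (biSup_mono (singleConnected_subset N)) _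

end Gains

/-! ### Limits of the array gains -/

theorem continuous_boundFull (N : ℕ) :
    Continuous fun q : (Fin N → ℂ) × (Fin N → ℂ) => boundFull q.1 q.2 := by
  unfold boundFull
  exact continuous_const.mul ((continuous_fst.dotProduct continuous_snd).norm.add
    ((continuous_l2norm.comp continuous_fst).mul (continuous_l2norm.comp continuous_snd)))

theorem continuous_boundDiag (N : ℕ) :
    Continuous fun q : (Fin N → ℂ) × (Fin N → ℂ) => boundDiag q.1 q.2 := by
  unfold boundDiag dotProduct
  fun_prop

theorem l2norm_legendreVec_le {N : ℕ} {t : ℝ} (ht : t ∈ Set.Icc (-1 : ℝ) 1) :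
    l2norm (legendreVec N t) ≤ N := by
  have h := star_legendreVec_dotProduct N t
  rw [star_dotProduct_self, Complex.ofReal_inj] at h
  refine abs_le_of_sq_le_sq' ?_ (Nat.cast_nonneg N) |>.2
  rw [h, ← sum_two_mul_add_one]
  exact Finset.sum_le_sum fun l _ => legendre_eval_sq_le l ht

theorem l2norm_legendreVec_one (N : ℕ) : l2norm (legendreVec N 1) = N := by
  have h := star_legendreVec_dotProduct N 1
  rw [star_dotProduct_self, Complex.ofReal_inj] at h
  refine (sq_eq_sq₀ (l2norm_nonneg _) (Nat.cast_nonneg N)).1 ?_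
  rw [h, ← sum_two_mul_add_one]
  exact Finset.sum_congr rfl fun l _ => legendre_eval_sq_of_sq_eq_one l (Or.inl rfl)

/-- The whitened array vectors converge to vectors of norm at most `N`, and of norm `N` in the
end-fire direction. -/
theorem exists_tendsto_whitened_l2norm (N : ℕ) {lam R : ℝ} (hlam : 0 < lam) (hR : 0 < R) :
    ∃ w : ℝ → Fin N → ℂ, (∀ α, Tendsto (fun d => whitened N lam R d α) (𝓝[>] 0) (𝓝 (w α))) ∧
      (∀ α, l2norm (w α) ≤ N) ∧ l2norm (w 0) = N := by
  obtain ⟨K₀, hK₀, hlim⟩ := exists_tendsto_whitened N hlam hR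
  have hnorm : ∀ α, l2norm (K₀ *ᵥ legendreVec N (Real.cos α)) =
      l2norm (legendreVec N (Real.cos α)) := fun α =>
    l2norm_eq_of_dotProduct (unitary_star_mulVec_dotProduct hK₀ _)
  refine ⟨fun α => K₀ *ᵥ legendreVec N (Real.cos α), hlim, fun α => ?_, ?_⟩
  · rw [hnorm]
    exact l2norm_legendreVec_le ⟨Real.neg_one_le_cos α, Real.cos_le_one α⟩
  · rw [hnorm, Real.cos_zero, l2norm_legendreVec_one]

theorem ofReal_sq_le_pow_four {N : ℕ} {B : ℝ} (h0 : 0 ≤ B) (hB : B ≤ (N : ℝ) ^ 2) :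
    ENNReal.ofReal (B ^ 2) ≤ (N : ℝ≥0∞) ^ 4 := by
  have : (N : ℝ≥0∞) ^ 4 = ENNReal.ofReal (((N : ℝ) ^ 2) ^ 2) := by
    rw [← pow_mul, ENNReal.ofReal_pow (Nat.cast_nonneg N), ENNReal.ofReal_natCast]
  rw [this]
  gcongr

theorem tendsto_ofReal_l2norm {N : ℕ} {f : ℝ → Fin N → ℂ} {w : Fin N → ℂ}
    (hf : Tendsto f (𝓝[>] 0) (𝓝 w)) (hw : l2norm w = N) :
    Tendsto (fun d => ENNReal.ofReal ((l2norm (f d) ^ 2) ^ 2)) (𝓝[>] 0) (𝓝 ((N : ℝ≥0∞) ^ 4)) := by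
  have : (N : ℝ≥0∞) ^ 4 = ENNReal.ofReal ((l2norm w ^ 2) ^ 2) := by
    rw [hw, ← pow_mul, ENNReal.ofReal_pow (Nat.cast_nonneg N), ENNReal.ofReal_natCast]
  rw [this]
  exact ENNReal.tendsto_ofReal ((((continuous_l2norm.tendsto w).comp hf).pow 2).pow 2)

end RIS

theorem theorem1 (N : ℕ) (hN : 1 ≤ N) (lam R γDR γRS : ℝ)
    (hlam : 0 < lam) (hR : 0 < R) (hγDR : 0 < γDR) (hγRS : 0 < γRS) :
    -- the conventional end-fire transmit array gain tends to `N²`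
    Tendsto (fun d : ℝ => RIS.transmitGain N lam R d 0) (𝓝[>] 0) (𝓝 ((N : ℂ) ^ 2)) ∧
    -- for all directions the limits of the gains of the decoupled arrays exist, at most `(N²)²`
    (∀ αRx αTx : ℝ,
      (∃ L : ℝ≥0∞, Tendsto (fun d : ℝ => RIS.gainDDN N lam R γDR γRS αRx αTx d)
          (𝓝[>] 0) (𝓝 L) ∧ L ≤ (N : ℝ≥0∞) ^ 4) ∧
      (∃ L : ℝ≥0∞, Tendsto (fun d : ℝ => RIS.gainBDDN N lam R γDR γRS αRx αTx d)
          (𝓝[>] 0) (𝓝 L) ∧ L ≤ (N : ℝ≥0∞) ^ 4)) ∧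
    -- the bound is attained in end-fire direction by both architectures
    Tendsto (fun d : ℝ => RIS.gainDDN N lam R γDR γRS Real.pi 0 d)
      (𝓝[>] 0) (𝓝 ((N : ℝ≥0∞) ^ 4)) ∧
    Tendsto (fun d : ℝ => RIS.gainBDDN N lam R γDR γRS Real.pi 0 d)
      (𝓝[>] 0) (𝓝 ((N : ℝ≥0∞) ^ 4)) ∧
    -- for every spacing and all directions, the decoupling network does not change the gain of the
    -- BD-RIS, and the conventional diagonal RIS is not better than the BD-RIS
    (∀ αRx αTx d : ℝ, 0 < d →
      RIS.gainBDDN N lam R γDR γRS αRx αTx d = RIS.gainBD N lam R γDR γRS αRx αTx d ∧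
      RIS.gainD N lam R γDR γRS αRx αTx d ≤ RIS.gainBD N lam R γDR γRS αRx αTx d) ∧
    -- in specular directions, in particular in end-fire (`α = 0`), `A_D^DN = A_BD ≥ A_D`
    (∀ α d : ℝ, 0 < d →
      RIS.gainDDN N lam R γDR γRS (Real.pi - α) α d =
        RIS.gainBD N lam R γDR γRS (Real.pi - α) α d ∧
      RIS.gainD N lam R γDR γRS (Real.pi - α) α d ≤
        RIS.gainBD N lam R γDR γRS (Real.pi - α) α d) ∧
    -- the conventional diagonal RIS cannot exceed the gain `N⁴` in any direction
    (∀ αRx αTx : ℝ, ∀ ε : ℝ≥0∞, 0 < ε →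
      ∀ᶠ d in 𝓝[>] (0 : ℝ),
        RIS.gainD N lam R γDR γRS αRx αTx d ≤ (N : ℝ≥0∞) ^ 4 + ε) := by
  obtain ⟨w, hlim, hle, hw0⟩ := RIS.exists_tendsto_whitened_l2norm N hlam hR
  have hpos : ∀ᶠ d in 𝓝[>] (0 : ℝ), 0 < d := self_mem_nhdsWithin
  have hfull : ∀ αRx αTx, RIS.boundFull (w αRx) (w αTx) ≤ (N : ℝ) ^ 2 := by
    intro αRx αTx
    refine (RIS.boundFull_le _ _).trans ?_
    rw [sq]
    exact mul_le_mul (hle _) (hle _) (RIS.l2norm_nonneg _) (Nat.cast_nonneg N)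
  have hlimFull : ∀ αRx αTx, Tendsto (fun d => ENNReal.ofReal (RIS.boundFull
      (RIS.whitened N lam R d αRx) (RIS.whitened N lam R d αTx) ^ 2)) (𝓝[>] 0)
      (𝓝 (ENNReal.ofReal (RIS.boundFull (w αRx) (w αTx) ^ 2))) := fun αRx αTx =>
    ENNReal.tendsto_ofReal ((((RIS.continuous_boundFull N).tendsto (w αRx, w αTx)).comp
      ((hlim αRx).prodMk_nhds (hlim αTx))).pow 2)
  have hlimDiag : ∀ αRx αTx, Tendsto (fun d => ENNReal.ofReal (RIS.boundDiag
      (RIS.whitened N lam R d αRx) (RIS.whitened N lam R d αTx) ^ 2)) (𝓝[>] 0)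
      (𝓝 (ENNReal.ofReal (RIS.boundDiag (w αRx) (w αTx) ^ 2))) := fun αRx αTx =>
    ENNReal.tendsto_ofReal ((((RIS.continuous_boundDiag N).tendsto (w αRx, w αTx)).comp
      ((hlim αRx).prodMk_nhds (hlim αTx))).pow 2)
  have hpi : ∀ d, RIS.whitened N lam R d Real.pi = star (RIS.whitened N lam R d 0) := fun d => by
    rw [← RIS.whitened_pi_sub, sub_zero]
  refine ⟨?_, fun αRx αTx => ⟨⟨_, (hlimDiag αRx αTx).congr' ?_, RIS.ofReal_sq_le_pow_four
    (RIS.boundDiag_nonneg _ _) ((RIS.boundDiag_le_boundFull _ _).trans (hfull _ _))⟩,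
    ⟨_, (hlimFull αRx αTx).congr' ?_, RIS.ofReal_sq_le_pow_four
    (RIS.boundFull_nonneg _ _) (hfull _ _)⟩⟩, ?_, ?_, fun αRx αTx d hd => ⟨?_, ?_⟩,
    fun α d hd => ⟨?_, ?_⟩, fun αRx αTx ε hε => ?_⟩
  · have h : Tendsto (fun d => ((RIS.l2norm (RIS.whitened N lam R d 0) ^ 2 : ℝ) : ℂ)) (𝓝[>] 0)
        (𝓝 ((RIS.l2norm (w 0) ^ 2 : ℝ) : ℂ)) :=
      (Complex.continuous_ofReal.tendsto _).comp
        (((RIS.continuous_l2norm.tendsto _).comp (hlim 0)).pow 2)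
    rw [hw0, Complex.ofReal_pow, Complex.ofReal_natCast] at h
    refine h.congr' ?_
    filter_upwards [hpos] with d hd
    rw [RIS.transmitGain_eq hlam hR hd, RIS.star_dotProduct_self]
  · filter_upwards [hpos] with d hd
    exact (RIS.gainDDN_eq hlam hR hγDR hγRS hd _ _).symm
  · filter_upwards [hpos] with d hd
    exact (RIS.gainBDDN_eq hlam hR hγDR hγRS hd _ _).symm
  · refine (RIS.tendsto_ofReal_l2norm (hlim 0) hw0).congr' ?_
    filter_upwards [hpos] with d hd
    rw [RIS.gainDDN_eq hlam hR hγDR hγRS hd, hpi, RIS.boundDiag_star_self]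
  · refine (RIS.tendsto_ofReal_l2norm (hlim 0) hw0).congr' ?_
    filter_upwards [hpos] with d hd
    rw [RIS.gainBDDN_eq hlam hR hγDR hγRS hd, hpi, RIS.boundFull_star_self]
  · rw [RIS.gainBDDN_eq hlam hR hγDR hγRS hd, RIS.gainBD_eq hlam hR hγDR hγRS hd]
  · exact RIS.gainD_le_gainBD _ _ _ _ _ _ _ _
  · rw [RIS.gainDDN_eq hlam hR hγDR hγRS hd, RIS.gainBD_eq hlam hR hγDR hγRS hd,
      RIS.whitened_pi_sub, RIS.boundDiag_star_self, RIS.boundFull_star_self]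
  · exact RIS.gainD_le_gainBD _ _ _ _ _ _ _ _
  · have hL : ENNReal.ofReal (RIS.boundFull (w αRx) (w αTx) ^ 2) < (N : ℝ≥0∞) ^ 4 + ε :=
      (RIS.ofReal_sq_le_pow_four (RIS.boundFull_nonneg _ _) (hfull αRx αTx)).trans_lt
        (ENNReal.lt_add_right (ENNReal.pow_ne_top (ENNReal.natCast_ne_top N)) hε.ne')
    filter_upwards [hpos, (hlimFull αRx αTx).eventually_lt_const hL] with d hd hlt
    rw [← RIS.gainBD_eq hlam hR hγDR hγRS hd] at hlt
    exact (RIS.gainD_le_gainBD _ _ _ _ _ _ _ _).trans hlt.le
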